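/- Let $k\ge 1$, $\lambda>0$, $-\frac{k+1}{2}<\alpha<-\frac k2$, $\beta\neq 0$ and $-\alpha-\frac k2-1<\beta<-\alpha-\frac k2$. Let $g:(0,\infty)^k\to\mathbb R$ be a generalized tempered Hermite kernel, i.e. a nonzero measurable function with $g(c\mathbf x)=c^{\alpha}g(\mathbf x)$ for all $c>0$ and $\int_{(0,\infty)^k}|g(\mathbf x)g(\mathbf 1+\mathbf x)|e^{-2\lambda u(x_1+\dots+x_k)}\,d\mathbf x<\infty$ for all $u>0$. Suppose that $g$ has product form $g(x_1,\dots,x_k)=\prod_{i=1}^k g(x_i)$ with a function of one variable, again denoted $g$, which satisfies $g(0)=0$. Put $x_+^\beta=x^\beta$ for $x>0$, $x_+^\beta=0$ for $x\le 0$, and $$l_t^\beta(u)=\frac1\beta\left[(t-u)_+^\beta-(-u)_+^\beta\right],\qquad t,u\in\mathbb R .$$ Let $W$ be Gaussian white noise on $\mathbb R$ with Lebesgue control measure, let $I_k$ be the $k$-fold Wiener–Itô integral with respect to $W$, and let $Z^{\lambda,\beta}(t)=I_k(h_t^{\lambda,\beta})$, $t\in\mathbb R$, with $$h_t^{\lambda,\beta}(\mathbf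 x)=\int_{\mathbb R} l_t^\beta(u)\,g(u-x_1,\dots,u-x_k)\prod_{i=1}^k e^{-\lambda(u-x_i)}\,1_{\{u>x_1,\dots,u>x_k\}}\,du .$$ Then $h_t^{\lambda,\beta}$ is defined almost everywhere and belongs to $L^2(\mathbb R^k)$, $Z^{\lambda,\beta}(t)$ is square integrable, and for all $s,t\in\mathbb R$ the covariance of $Z^{\lambda,\beta}(t)$ and $Z^{\lambda,\beta}(s)$ is $$E\big(Z^{\lambda,\beta}(t)Z^{\lambda,\beta}(s)\big)=k!\int_{\mathbb R}\int_{\mathbb R} e^{-\lambda k|u-v|}\,|u-v|^{2\alpha+k}\,l_s^\beta(u)\,l_t^\beta(v)\left[\int_0^\infty g(x)g(1+x)e^{-2\lambda|u-v|x}\,dx\right]^k du\,dv ,$$ where the integrals converge absolutely. -/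

import Mathlib

open MeasureTheory ProbabilityTheory
open scoped ENNReal

noncomputable section

namespace TemperedHermite

/-- The open orthant of points of `ℝ^k` all of whose coordinates are positive. -/
def posOrthant (k : ℕ) : Set (Fin k → ℝ) := {x | ∀ i, 0 < x i}

/-- Generalized tempered Hermite kernel of order `k`, homogeneity degree `α` and tempering
parameter `lam`: a nonzero measurable function on the positive orthant, homogeneous of degree
`α ∈ (-(k+1)/2, -k/2)`, with the tempered integrability condition. Only the values of `g` on the
positive orthant matter. -/
structure IsTemperedHermiteKernel (k : ℕ) (α lam : ℝ) (g : (Fin k → ℝ) → ℝ) : Prop where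
  measurable : Measurable ((posOrthant k).domRestrict g)
  nonzero : ∃ x ∈ posOrthant k, g x ≠ 0
  lower : -((k : ℝ) + 1) / 2 < α
  upper : α < -(k : ℝ) / 2
  homogeneous : ∀ c : ℝ, 0 < c → ∀ x ∈ posOrthant k, g (fun i => c * x i) = c ^ α * g x
  integrable : ∀ u : ℝ, 0 < u →
    IntegrableOn (fun x : Fin k → ℝ =>
      |g x * g (fun i => 1 + x i)| * Real.exp (-2 * lam * u * ∑ i, x i)) (posOrthant k)

/-- The filter `l_t^β(s) = β⁻¹ ((t - s)₊^β - (-s)₊^β)`, used for `β ≠ 0`. There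
`(max x 0) ^ β` is `x ^ β` for `0 < x` and `0` for `x ≤ 0`, also when `β` is negative. -/
def filterFun (β t s : ℝ) : ℝ := 1 / β * ((max (t - s) 0) ^ β - (max (-s) 0) ^ β)

/-- The integrand (as a function of `s`) defining the filtered tempered kernel at `x`. -/
def kernelIntegrand {k : ℕ} (g : (Fin k → ℝ) → ℝ) (lam β t : ℝ) (x : Fin k → ℝ) : ℝ → ℝ :=
  {s : ℝ | ∀ i, x i < s}.indicator fun s =>
    filterFun β t s * g (fun i => s - x i) * ∏ i, Real.exp (-lam * (s - x i))

/-- The filtered tempered kernel `h_t^{λ,β}` on `ℝ^k`. -/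
def filteredKernel {k : ℕ} (g : (Fin k → ℝ) → ℝ) (lam β t : ℝ) (x : Fin k → ℝ) : ℝ :=
  ∫ s, kernelIntegrand g lam β t x s

/-- Gaussian white noise on `ℝ` with Lebesgue control measure: a centred Gaussian family indexed
by the Borel sets of finite Lebesgue measure, with `E[W(A) W(B)] = |A ∩ B|`. -/
structure IsWhiteNoise {Ω : Type*} [MeasurableSpace Ω] (P : Measure Ω)
    (W : Set ℝ → Ω → ℝ) : Prop where
  gaussian : IsGaussianProcess
    (fun A : {A : Set ℝ // MeasurableSet A ∧ volume A < ∞} => W A.1) P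
  mean_zero : ∀ A : Set ℝ, MeasurableSet A → volume A < ∞ → ∫ ω, W A ω ∂P = 0
  cov_eq : ∀ A B : Set ℝ, MeasurableSet A → volume A < ∞ → MeasurableSet B → volume B < ∞ →
    ∫ ω, W A ω * W B ω ∂P = volume.real (A ∩ B)

/-- The graph of the `k`-fold Wiener–Itô integral, as a subspace of `L²(ℝ^k) × L²(P)`. The
integral sends the indicator of a box `A₁ × ⋯ × A_k` with pairwise disjoint sides of finite
measure to `W(A₁) ⋯ W(A_k)`; it is extended linearly to the span of these indicators (the simple
functions vanishing on the diagonals) and then by `L²` continuity, i.e. by closing the graph. -/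
def wienerItoGraph {Ω : Type*} [MeasurableSpace Ω] (P : Measure Ω) (W : Set ℝ → Ω → ℝ) (k : ℕ) :
    Submodule ℝ (Lp ℝ 2 (volume : Measure (Fin k → ℝ)) × Lp ℝ 2 P) :=
  (Submodule.span ℝ
    {p : Lp ℝ 2 (volume : Measure (Fin k → ℝ)) × Lp ℝ 2 P | ∃ A : Fin k → Set ℝ,
      (∀ i, MeasurableSet (A i) ∧ volume (A i) < ∞) ∧
      (∀ i j, i ≠ j → Disjoint (A i) (A j)) ∧
      p.1 =ᵐ[volume] (Set.univ.pi A).indicator (fun _ => (1 : ℝ)) ∧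
      p.2 =ᵐ[P] fun ω => ∏ i, W (A i) ω}).topologicalClosure

open Classical in
/-- The `k`-fold Wiener–Itô integral `I_k(f)` of a square integrable function `f` on `ℝ^k`
(a version of the almost surely unique random variable; `0` if there is none). -/
def wienerItoIntegral {Ω : Type*} [MeasurableSpace Ω] (P : Measure Ω) (W : Set ℝ → Ω → ℝ)
    {k : ℕ} (f : (Fin k → ℝ) → ℝ) : Ω → ℝ :=
  if h : ∃ X : Lp ℝ 2 P, ∃ F : Lp ℝ 2 (volume : Measure (Fin k → ℝ)),
      F =ᵐ[volume] f ∧ (F, X) ∈ wienerItoGraph P W k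
  then h.choose else 0

/-- The filtered tempered generalized Hermite process `Z^{λ,β}(t) = I_k(h_t^{λ,β})`. -/
def filteredProcess {Ω : Type*} [MeasurableSpace Ω] (P : Measure Ω) (W : Set ℝ → Ω → ℝ)
    {k : ℕ} (g : (Fin k → ℝ) → ℝ) (lam β t : ℝ) : Ω → ℝ :=
  wienerItoIntegral P W (filteredKernel g lam β t)

/-- The integrand of the covariance formula at `(u, v)`, for a kernel of homogeneity degree `α`
with one-dimensional factor `g₁`. -/
def covIntegrand (k : ℕ) (α lam β : ℝ) (g₁ : ℝ → ℝ) (s t : ℝ) (p : ℝ × ℝ) : ℝ :=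
  Real.exp (-lam * k * |p.1 - p.2|) * |p.1 - p.2| ^ (2 * α + k) *
    filterFun β s p.1 * filterFun β t p.2 *
    (∫ x in Set.Ioi (0 : ℝ), g₁ x * g₁ (1 + x) * Real.exp (-2 * lam * |p.1 - p.2| * x)) ^ k

end TemperedHermite

end

/-!
# Covariance of the filtered tempered Hermite process of product form

Homogeneity forces a kernel of product form to be `C ^ k * ∏ x_i ^ γ` with `γ = α / k`, and
`-1 < γ < -1/2` (`IsTemperedHermiteKernel.exists_eq_mul_rpow`). The filtered kernel is therefore
`h_t(x) = C ^ k ∫ l_t(u) ∏ φ(u - x_i) du` with `φ(y) = y₊^γ e^{-λ y}`, and the inner product of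
`h_s` and `h_t` in `L²(ℝ^k)` is, by Fubini, the integral of `l_s(u) l_t(v)` against the `k`-th power
of `∫ φ(u - x) φ(v - x) dx`. The substitution `min u v - x = |u - v| y` turns this autocorrelation
into the expression of the covariance formula (`temperedPower_autocorrelation`).

Fubini needs `∫∫ |l_s(u) l_t(v)| |u - v|^d e^{-λk|u - v|} du dv < ∞` with `d = 2α + k ∈ (-1, 0)`.
The exponential makes the power kernel belong to `L^q` for every `1 ≤ q < -1/d`, and the bounds on
`β` put the filters into the dual exponent of Young's inequality for `q` close to `-1/d`
(`integrable_filterFun_mul_filterFun`); this covers also the `β ≤ -1/2` for which the filters are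
not square integrable.

On the probabilistic side, the Itô isometry `E[I(F) I(G)] = ∑_σ ⟪F, G ∘ σ⟫` is proved on boxes by
cutting their sides into common disjoint atoms, on which white noise is independent
(`IsWhiteNoise.integral_prod_mul_prod`), and extends to the closed graph of the integral by
bilinearity and continuity. It also shows that the projection of the graph to `L²(ℝ^k)` has closed
range; since boxes with disjoint sides are total, every square integrable function has an integral
(`exists_mem_wienerItoGraph`). As `h_t` is symmetric, the sum over `σ` is `k!` times one term.
-/

namespace TemperedHermite

/-! ### Moments of products of independent centred variables -/

section Moments

variable {Ω ι : Type*} [MeasurableSpace Ω] {P : Measure Ω} [Fintype ι]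

lemma integral_prod_comp_of_iIndepFun {κ τ : Type*} [Fintype κ] [DecidableEq κ] [Fintype τ]
    {ξ : κ → Ω → ℝ} (hξ : iIndepFun ξ P) (hm : ∀ p, AEMeasurable (ξ p) P) (φ : τ → κ) :
    ∫ ω, ∏ s, ξ (φ s) ω ∂P =
      ∏ p, ∫ ω, ξ p ω ^ (Finset.univ.filter fun s => φ s = p).card ∂P := by
  have h : ∀ ω, ∏ s, ξ (φ s) ω =
      ∏ p, (fun x : ℝ => x ^ (Finset.univ.filter fun s => φ s = p).card) (ξ p ω) := by
    intro ω
    rw [← Finset.prod_fiberwise (s := Finset.univ) (g := φ)]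
    refine Finset.prod_congr rfl fun p _ => ?_
    exact Finset.prod_eq_pow_card fun s hs => by rw [(Finset.mem_filter.1 hs).2]
  simp_rw [h]
  exact hξ.integral_fun_prod_comp
    (f := fun p (x : ℝ) => x ^ (Finset.univ.filter fun s => φ s = p).card) hm
    fun p => (measurable_id.pow_const _).aestronglyMeasurable

/-- Indices of the factors obtained by choosing one summand from each row `some i` and each
column `some j` of a matrix indexed by `Option ι × Option ι`. -/
def pairIndex (f h : ι → Option ι) : ι ⊕ ι → Option ι × Option ι :=
  Sum.elim (fun i => (some i, f i)) (fun j => (h j, some j))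

/-- A factor that occurs only once makes the expectation vanish; in the remaining case the chosen
rows and columns are matched by a permutation. -/
lemma exists_perm_of_integral_ne_zero [DecidableEq ι]
    {ξ : Option ι × Option ι → Ω → ℝ} (hξ : iIndepFun ξ P)
    (hm : ∀ p, AEMeasurable (ξ p) P) (h0 : ∀ p, ∫ ω, ξ p ω ∂P = 0) (f h : ι → Option ι)
    (hne : ∫ ω, ∏ s, ξ (pairIndex f h s) ω ∂P ≠ 0) :
    ∃ σ : Equiv.Perm ι, (fun i => some (σ i)) = f ∧ (fun j => some (σ.symm j)) = h := by
  rw [integral_prod_comp_of_iIndepFun hξ hm, Finset.prod_ne_zero_iff] at hne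
  have key : ∀ s, ∃ s', s' ≠ s ∧ pairIndex f h s' = pairIndex f h s := by
    intro s
    by_contra! hcon
    refine hne (pairIndex f h s) (Finset.mem_univ _) ?_
    have : (Finset.univ.filter fun s' => pairIndex f h s' = pairIndex f h s) = {s} := by
      ext s'
      simp only [Finset.mem_filter, Finset.mem_univ, true_and, Finset.mem_singleton]
      refine ⟨fun hs => ?_, fun hs => by rw [hs]⟩
      by_contra hss
      exact hcon s' hss hs
    rw [this]
    simpa using h0 _
  have h1 : ∀ i, ∃ j, f i = some j ∧ h j = some i := by
    intro i
    obtain ⟨s', hs', he⟩ := key (Sum.inl i)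
    rcases s' with i' | j
    · simp only [pairIndex, Sum.elim_inl, Prod.mk.injEq, Option.some.injEq] at he
      exact absurd (by rw [he.1]) hs'
    · simp only [pairIndex, Sum.elim_inl, Sum.elim_inr, Prod.mk.injEq] at he
      exact ⟨j, he.2.symm, he.1⟩
  have h2 : ∀ j, ∃ i, h j = some i ∧ f i = some j := by
    intro j
    obtain ⟨s', hs', he⟩ := key (Sum.inr j)
    rcases s' with i | j'
    · simp only [pairIndex, Sum.elim_inl, Sum.elim_inr, Prod.mk.injEq] at he
      exact ⟨i, he.1.symm, he.2⟩
    · simp only [pairIndex, Sum.elim_inr, Prod.mk.injEq, Option.some.injEq] at he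
      exact absurd (by rw [he.2]) hs'
  choose σ hσ hσ' using h1
  choose τ hτ hτ' using h2
  refine ⟨⟨σ, τ, fun i => ?_, fun j => ?_⟩, funext fun i => (hσ i).symm,
    funext fun j => (hτ j).symm⟩
  · exact Option.some.inj ((hτ (σ i)).symm.trans (hσ' i))
  · exact Option.some.inj ((hσ (τ j)).symm.trans (hτ' j))

lemma integral_prod_pairIndex_perm {ξ : Option ι × Option ι → Ω → ℝ} (hξ : iIndepFun ξ P)
    (hm : ∀ p, AEMeasurable (ξ p) P) (σ : Equiv.Perm ι) :
    ∫ ω, ∏ s, ξ (pairIndex (fun i => some (σ i)) (fun j => some (σ.symm j)) s) ω ∂P =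
      ∏ i, ∫ ω, ξ (some i, some (σ i)) ω ^ 2 ∂P := by
  have h : ∀ ω, ∏ s, ξ (pairIndex (fun i => some (σ i)) (fun j => some (σ.symm j)) s) ω =
      ∏ i, (fun x : ℝ => x ^ 2) (ξ (some i, some (σ i)) ω) := by
    intro ω
    rw [Fintype.prod_sum_type]
    simp only [pairIndex, Sum.elim_inl, Sum.elim_inr]
    rw [← Equiv.prod_comp σ (fun j => ξ (some (σ.symm j), some j) ω), ← Finset.prod_mul_distrib]
    simp [sq]
  simp_rw [h]
  have hinj : Function.Injective fun i => ((some i, some (σ i)) : Option ι × Option ι) := by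
    intro i i' hi
    simpa using (congrArg Prod.fst hi)
  exact (hξ.precomp hinj).integral_fun_prod_comp (f := fun _ (x : ℝ) => x ^ 2) (fun i => hm _)
    fun p => (measurable_id.pow_const _).aestronglyMeasurable

/-- Wick's formula for the row sums and column sums of a matrix of independent centred variables
with all moments: only the pairings of rows with columns contribute. -/
lemma integral_prod_rowSum_mul_prod_colSum [DecidableEq ι]
    {ξ : Option ι × Option ι → Ω → ℝ} (hξ : iIndepFun ξ P)
    (hL : ∀ p (q : ℝ≥0∞), q ≠ ∞ → MemLp (ξ p) q P) (h0 : ∀ p, ∫ ω, ξ p ω ∂P = 0) :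
    ∫ ω, (∏ i, ∑ b, ξ (some i, b) ω) * ∏ j, ∑ a, ξ (a, some j) ω ∂P =
      ∑ σ : Equiv.Perm ι, ∏ i, ∫ ω, ξ (some i, some (σ i)) ω ^ 2 ∂P := by
  have hm : ∀ p, AEMeasurable (ξ p) P := fun p => (hL p 1 (by simp)).aemeasurable
  have hP := hξ.isProbabilityMeasure
  have hexp : ∀ ω, (∏ i, ∑ b, ξ (some i, b) ω) * ∏ j, ∑ a, ξ (a, some j) ω =
      ∑ q : (ι → Option ι) × (ι → Option ι), ∏ s, ξ (pairIndex q.1 q.2 s) ω := by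
    intro ω
    rw [Fintype.prod_sum, Fintype.prod_sum, Finset.sum_mul_sum, Fintype.sum_prod_type]
    refine Finset.sum_congr rfl fun f _ => Finset.sum_congr rfl fun h _ => ?_
    simp [Fintype.prod_sum_type, pairIndex]
  have hint : ∀ q : (ι → Option ι) × (ι → Option ι),
      Integrable (fun ω => ∏ s, ξ (pairIndex q.1 q.2 s) ω) P := by
    intro q
    have := MemLp.prod' (s := Finset.univ) (f := fun s => ξ (pairIndex q.1 q.2 s))
      (p := fun _ => ((Fintype.card (ι ⊕ ι) : ℝ≥0∞) )) (μ := P)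
      (fun s _ => hL _ _ (by simp))
    refine this.integrable ?_
    rw [Finset.sum_const, nsmul_eq_mul, Finset.card_univ, ENNReal.one_le_inv]
    exact ENNReal.mul_inv_le_one _
  simp_rw [hexp]
  rw [integral_finsetSum _ fun q _ => hint q]
  symm
  refine Fintype.sum_of_injective
    (fun σ : Equiv.Perm ι => ((fun i => some (σ i)), (fun j => some (σ.symm j)))) ?_ _ _ ?_ ?_
  · intro σ σ' h
    ext i
    simpa using congrFun (congrArg Prod.fst h) i
  · rintro ⟨f, h⟩ hq
    by_contra hne
    obtain ⟨σ, h1, h2⟩ := exists_perm_of_integral_ne_zero hξ hm h0 f h hne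
    exact hq ⟨σ, by rw [← h1, ← h2]⟩
  · intro σ
    exact (integral_prod_pairIndex_perm hξ hm σ).symm

end Moments

/-! ### White noise on disjoint sets -/

namespace IsWhiteNoise

variable {Ω : Type*} [MeasurableSpace Ω] {P : Measure Ω} {W : Set ℝ → Ω → ℝ}

lemma memLp (hW : IsWhiteNoise P W) {A : Set ℝ} (hA : MeasurableSet A) (hA' : volume A < ∞)
    (q : ℝ≥0∞) (hq : q ≠ ∞) : MemLp (W A) q P :=
  (hW.gaussian.hasGaussianLaw_eval ⟨A, hA, hA'⟩).memLp hq

lemma integrable_mul (hW : IsWhiteNoise P W) {A B : Set ℝ} (hA : MeasurableSet A)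
    (hA' : volume A < ∞) (hB : MeasurableSet B) (hB' : volume B < ∞) :
    Integrable (fun ω => W A ω * W B ω) P :=
  (hW.memLp hA hA' 2 (by simp)).integrable_mul (hW.memLp hB hB' 2 (by simp))

lemma iIndepFun (hW : IsWhiteNoise P W) {κ : Type*} [Finite κ] {C : κ → Set ℝ}
    (hC : ∀ p, MeasurableSet (C p)) (hC' : ∀ p, volume (C p) < ∞)
    (hd : Pairwise (Function.onFun Disjoint C)) : iIndepFun (fun p => W (C p)) P := by
  have hP := hW.gaussian.isProbabilityMeasure
  have hG : IsGaussianProcess (fun p => W (C p)) P :=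
    hW.gaussian.comp_right fun p => ⟨C p, hC p, hC' p⟩
  have := Fintype.ofFinite κ
  have hlaw : HasGaussianLaw (fun ω p => W (C p) ω) P :=
    (hG.hasGaussianLaw Finset.univ).map
      (ContinuousLinearMap.pi fun p => ContinuousLinearMap.proj
        (⟨p, Finset.mem_univ p⟩ : {x // x ∈ (Finset.univ : Finset κ)}))
  refine hlaw.iIndepFun_of_covariance_eq_zero fun i j hij => ?_
  rw [covariance_eq_sub (hW.memLp (hC i) (hC' i) 2 (by simp))
    (hW.memLp (hC j) (hC' j) 2 (by simp))]
  simp only [Pi.mul_apply]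
  rw [hW.cov_eq _ _ (hC i) (hC' i) (hC j) (hC' j), hW.mean_zero _ (hC i) (hC' i),
    (hd hij).inter_eq]
  simp

/-- White noise is almost surely finitely additive: the difference has variance zero. -/
lemma ae_eq_sum (hW : IsWhiteNoise P W) {κ : Type*} [Fintype κ] {A : Set ℝ} {C : κ → Set ℝ}
    (hA : MeasurableSet A) (hA' : volume A < ∞) (hC : ∀ p, MeasurableSet (C p))
    (hd : Pairwise (Function.onFun Disjoint C)) (hU : A = ⋃ p, C p) :
    W A =ᵐ[P] fun ω => ∑ p, W (C p) ω := by
  have hP := hW.gaussian.isProbabilityMeasure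
  have hC' : ∀ p, volume (C p) < ∞ := fun p =>
    (measure_mono (hU ▸ Set.subset_iUnion C p)).trans_lt hA'
  set D : Ω → ℝ := fun ω => W A ω - ∑ p, W (C p) ω with hD
  have hDL : MemLp D 2 P := (hW.memLp hA hA' 2 (by simp)).sub
    (memLp_finsetSum _ fun p _ => hW.memLp (hC p) (hC' p) 2 (by simp))
  have horth : ∀ B, MeasurableSet B → volume B < ∞ → ∫ ω, D ω * W B ω ∂P = 0 := by
    intro B hB hB'
    simp only [hD, sub_mul, Finset.sum_mul]
    rw [integral_sub (hW.integrable_mul hA hA' hB hB')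
      (integrable_finsetSum _ fun p _ => hW.integrable_mul (hC p) (hC' p) hB hB'),
      integral_finsetSum _ fun p _ => hW.integrable_mul (hC p) (hC' p) hB hB',
      hW.cov_eq _ _ hA hA' hB hB']
    simp_rw [hW.cov_eq _ _ (hC _) (hC' _) hB hB']
    rw [hU, Set.iUnion_inter, measureReal_iUnion_fintype, sub_self]
    · exact fun i j hij => (hd hij).mono Set.inter_subset_left Set.inter_subset_left
    · exact fun p => (hC p).inter hB
  have hDD : ∫ ω, D ω ^ 2 ∂P = 0 := by
    have : ∀ ω, D ω ^ 2 = D ω * W A ω - ∑ p, D ω * W (C p) ω := by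
      intro ω
      rw [← Finset.mul_sum, ← mul_sub, sq]
    simp_rw [this]
    have hi : ∀ B, MeasurableSet B → volume B < ∞ → Integrable (fun ω => D ω * W B ω) P :=
      fun B hB hB' => hDL.integrable_mul (hW.memLp hB hB' 2 (by simp))
    rw [integral_sub (hi A hA hA') (integrable_finsetSum _ fun p _ => hi _ (hC p) (hC' p)),
      integral_finsetSum _ fun p _ => hi _ (hC p) (hC' p), horth A hA hA']
    simp [horth _ (hC _) (hC' _)]
  rw [integral_eq_zero_iff_of_nonneg (fun ω => sq_nonneg _) hDL.integrable_sq] at hDD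
  filter_upwards [hDD] with ω hω
  simpa [hD, sub_eq_zero] using hω

variable {ι : Type*} [Fintype ι]

lemma memLp_prod (hW : IsWhiteNoise P W) {A : ι → Set ℝ} (hA : ∀ i, MeasurableSet (A i))
    (hA' : ∀ i, volume (A i) < ∞) : MemLp (fun ω => ∏ i, W (A i) ω) 2 P := by
  have hP := hW.gaussian.isProbabilityMeasure
  have := MemLp.prod' (s := Finset.univ) (f := fun i => W (A i))
    (p := fun _ => 2 * (Fintype.card ι : ℝ≥0∞)) (μ := P)
    (fun i _ => hW.memLp (hA i) (hA' i) _ (by finiteness))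
  refine this.mono_exponent ?_
  rw [Finset.sum_const, nsmul_eq_mul, Finset.card_univ, ENNReal.le_inv_iff_mul_le,
    ENNReal.mul_inv (by simp) (by simp)]
  calc (2 : ℝ≥0∞) * ((Fintype.card ι : ℝ≥0∞) * (2⁻¹ * (Fintype.card ι : ℝ≥0∞)⁻¹))
      = (2 * 2⁻¹) * ((Fintype.card ι : ℝ≥0∞) * (Fintype.card ι : ℝ≥0∞)⁻¹) := by ring
    _ ≤ 1 * 1 := mul_le_mul' (ENNReal.mul_inv_le_one _) (ENNReal.mul_inv_le_one _)
    _ = 1 := one_mul 1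

lemma integral_prod_eq_zero [Nonempty ι] (hW : IsWhiteNoise P W) {A : ι → Set ℝ}
    (hA : ∀ i, MeasurableSet (A i)) (hA' : ∀ i, volume (A i) < ∞)
    (hd : Pairwise (Function.onFun Disjoint A)) : ∫ ω, ∏ i, W (A i) ω ∂P = 0 := by
  rw [(hW.iIndepFun hA hA' hd).integral_fun_prod_eq_prod_integral
    fun i => (hW.memLp (hA i) (hA' i) 1 (by simp)).aestronglyMeasurable]
  obtain ⟨i⟩ := ‹Nonempty ι›
  exact Finset.prod_eq_zero (Finset.mem_univ i) (hW.mean_zero _ (hA i) (hA' i))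

/-- The isometry on boxes. Both families of sides are cut into the common atoms `A i ∩ B j`,
`A i \ ⋃ B` and `B j \ ⋃ A`, on which white noise is independent. -/
lemma integral_prod_mul_prod [DecidableEq ι] (hW : IsWhiteNoise P W) {A B : ι → Set ℝ}
    (hA : ∀ i, MeasurableSet (A i)) (hA' : ∀ i, volume (A i) < ∞)
    (hAd : Pairwise (Function.onFun Disjoint A))
    (hB : ∀ i, MeasurableSet (B i)) (hB' : ∀ i, volume (B i) < ∞)
    (hBd : Pairwise (Function.onFun Disjoint B)) :
    ∫ ω, (∏ i, W (A i) ω) * ∏ j, W (B j) ω ∂P =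
      ∑ σ : Equiv.Perm ι, ∏ i, volume.real (A i ∩ B (σ i)) := by
  have hUA : MeasurableSet (⋃ i, A i) := MeasurableSet.iUnion hA
  have hUB : MeasurableSet (⋃ i, B i) := MeasurableSet.iUnion hB
  -- `none` collects what the other family leaves over, so that every atom has finite measure
  let A₀ : Option ι → Set ℝ := fun a => a.elim ((⋃ i, B i) \ ⋃ i, A i) A
  let B₀ : Option ι → Set ℝ := fun b => b.elim ((⋃ i, A i) \ ⋃ i, B i) B
  let C : Option ι × Option ι → Set ℝ := fun p => A₀ p.1 ∩ B₀ p.2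
  have hA₀ : ∀ a, MeasurableSet (A₀ a) := by
    rintro (_ | i)
    exacts [hUB.diff hUA, hA i]
  have hB₀ : ∀ a, MeasurableSet (B₀ a) := by
    rintro (_ | i)
    exacts [hUA.diff hUB, hB i]
  have hdisj : ∀ {S T : ι → Set ℝ}, Pairwise (Function.onFun Disjoint S) →
      Pairwise (Function.onFun Disjoint fun a : Option ι => a.elim ((⋃ i, T i) \ ⋃ i, S i) S) := by
    intro S T hS
    rintro (_ | i) (_ | j) hij
    · exact absurd rfl hij
    · exact Set.disjoint_sdiff_left.mono_right (Set.subset_iUnion S j)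
    · exact Set.disjoint_sdiff_right.mono_left (Set.subset_iUnion S i)
    · exact hS fun h => hij (by rw [h])
  have hA₀d : Pairwise (Function.onFun Disjoint A₀) := hdisj hAd
  have hB₀d : Pairwise (Function.onFun Disjoint B₀) := hdisj hBd
  have hC : ∀ p, MeasurableSet (C p) := fun p => (hA₀ _).inter (hB₀ _)
  have hC' : ∀ p, volume (C p) < ∞ := by
    rintro ⟨_ | i, b⟩
    · exact (measure_mono (Set.inter_subset_left.trans Set.sdiff_subset)).trans_lt
        ((measure_iUnion_fintype_le _ _).trans_lt (ENNReal.sum_lt_top.2 fun j _ => hB' j))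
    · exact (measure_mono Set.inter_subset_left).trans_lt (hA' i)
  have hCd : Pairwise (Function.onFun Disjoint C) := by
    rintro ⟨a, b⟩ ⟨a', b'⟩ hne
    by_cases h : a = a'
    · have hb : b ≠ b' := fun hb => hne (by rw [h, hb])
      exact (hB₀d hb).mono Set.inter_subset_right Set.inter_subset_right
    · exact (hA₀d h).mono Set.inter_subset_left Set.inter_subset_left
  have hWA : ∀ i, W (A i) =ᵐ[P] fun ω => ∑ b, W (C (some i, b)) ω := by
    intro i
    refine hW.ae_eq_sum (hA i) (hA' i) (fun b => hC _) (fun b b' hb => hCd (by simpa using hb)) ?_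
    ext x
    simp only [C, A₀, B₀, Set.mem_iUnion, Set.mem_inter_iff, Option.elim_some]
    refine ⟨fun hx => ?_, fun ⟨_, hx, _⟩ => hx⟩
    by_cases hxB : ∃ j, x ∈ B j
    · obtain ⟨j, hj⟩ := hxB
      exact ⟨some j, hx, hj⟩
    · exact ⟨none, hx, Set.mem_iUnion.2 ⟨i, hx⟩, by simpa using hxB⟩
  have hWB : ∀ j, W (B j) =ᵐ[P] fun ω => ∑ a, W (C (a, some j)) ω := by
    intro j
    refine hW.ae_eq_sum (hB j) (hB' j) (fun b => hC _) (fun b b' hb => hCd (by simpa using hb)) ?_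
    ext x
    simp only [C, A₀, B₀, Set.mem_iUnion, Set.mem_inter_iff, Option.elim_some]
    refine ⟨fun hx => ?_, fun ⟨_, _, hx⟩ => hx⟩
    by_cases hxA : ∃ i, x ∈ A i
    · obtain ⟨i, hi⟩ := hxA
      exact ⟨some i, hi, hx⟩
    · exact ⟨none, ⟨Set.mem_iUnion.2 ⟨j, hx⟩, by simpa using hxA⟩, hx⟩
  have hae : (fun ω => (∏ i, W (A i) ω) * ∏ j, W (B j) ω) =ᵐ[P] fun ω =>
      (∏ i, ∑ b, W (C (some i, b)) ω) * ∏ j, ∑ a, W (C (a, some j)) ω := by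
    filter_upwards [ae_all_iff.2 hWA, ae_all_iff.2 hWB] with ω h1 h2
    simp [h1, h2]
  rw [integral_congr_ae hae, integral_prod_rowSum_mul_prod_colSum (hW.iIndepFun hC hC' hCd)
    (fun p q hq => hW.memLp (hC p) (hC' p) q hq) fun p => hW.mean_zero _ (hC p) (hC' p)]
  refine Finset.sum_congr rfl fun σ _ => Finset.prod_congr rfl fun i _ => ?_
  simp_rw [sq]
  rw [hW.cov_eq _ _ (hC _) (hC' _) (hC _) (hC' _), Set.inter_self]
  rfl

end IsWhiteNoise

/-! ### Off-diagonal boxes are total in `L²` -/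

/-- A square integrable function on `ℝ^k` whose integral over every box with pairwise disjoint
sides vanishes is zero: countably many such boxes with rational end points cover the complement of
the diagonals, and within one of them every measurable box again has pairwise disjoint sides. -/
lemma ae_eq_zero_of_forall_setIntegral_box_eq_zero {k : ℕ} {f : (Fin k → ℝ) → ℝ}
    (hf : MemLp f 2 volume)
    (h : ∀ A : Fin k → Set ℝ, (∀ i, MeasurableSet (A i) ∧ volume (A i) < ∞) →
      (∀ i j, i ≠ j → Disjoint (A i) (A j)) → ∫ x in Set.univ.pi A, f x = 0) :
    f =ᵐ[volume] 0 := by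
  let I : (Fin k → ℚ × ℚ) → Fin k → Set ℝ := fun q i => Set.Ioo ((q i).1 : ℝ) (q i).2
  -- on one rational box: a π-system argument
  have hbox : ∀ q : Fin k → ℚ × ℚ, (∀ i j, i ≠ j → Disjoint (I q i) (I q j)) →
      ∀ᵐ x ∂volume.restrict (Set.univ.pi (I q)), f x = 0 := by
    intro q hq
    set R := Set.univ.pi (I q) with hR
    have hRm : MeasurableSet R := MeasurableSet.univ_pi fun i => measurableSet_Ioo
    have hRv : volume R < ∞ := by
      rw [hR, volume_pi, Measure.pi_pi]
      exact ENNReal.prod_lt_top fun i _ => measure_Ioo_lt_top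
    have hfin : IsFiniteMeasure (volume.restrict R) := ⟨by simpa using hRv⟩
    have hfi : IntegrableOn f R := (hf.restrict R).integrable (by norm_num)
    have hE : ∀ E (_ : MeasurableSet E), ∫ x in E ∩ R, f x = 0 := by
      have hRR : ∫ x in R, f x = 0 :=
        h _ (fun i => ⟨measurableSet_Ioo, measure_Ioo_lt_top⟩) hq
      refine MeasurableSpace.induction_on_inter generateFrom_pi.symm isPiSystem_pi ?_ ?_ ?_ ?_
      · simp
      · rintro _ ⟨B, hB, rfl⟩
        rw [hR, ← Set.pi_inter_distrib]
        refine h _ (fun i => ⟨MeasurableSet.inter (s₁ := B i) (hB i (Set.mem_univ i))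
          measurableSet_Ioo,
          (measure_mono Set.inter_subset_right).trans_lt measure_Ioo_lt_top⟩) fun i j hij =>
          (hq i j hij).mono Set.inter_subset_right Set.inter_subset_right
      · intro E hE h0
        have := setIntegral_union (μ := volume) (f := f) (s := E ∩ R) (t := Eᶜ ∩ R)
          ((disjoint_compl_right (a := E)).mono Set.inter_subset_left Set.inter_subset_left)
          (hE.compl.inter hRm) (hfi.mono_set Set.inter_subset_right)
          (hfi.mono_set Set.inter_subset_right)
        rw [← Set.union_inter_distrib_right, Set.union_compl_self, Set.univ_inter, hRR, h0,
          zero_add] at this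
        exact this.symm
      · intro E hd hE h0
        rw [Set.iUnion_inter, integral_iUnion (fun i => (hE i).inter hRm)
          (fun i j hij => (hd hij).mono Set.inter_subset_left Set.inter_subset_left)
          (hfi.mono_set (Set.iUnion_subset fun i => Set.inter_subset_right))]
        simp [h0]
    exact hfi.ae_eq_zero_of_forall_setIntegral_eq_zero fun E hEm _ => by
      rw [Measure.restrict_restrict hEm]
      exact hE E hEm
  -- the diagonals are null sets
  have hdiag : ∀ i j : Fin k, i ≠ j → ∀ᵐ x : Fin k → ℝ, x i ≠ x j := by
    intro i j hij
    let L : (Fin k → ℝ) →ₗ[ℝ] ℝ :=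
      (LinearMap.proj i : (Fin k → ℝ) →ₗ[ℝ] ℝ) - LinearMap.proj j
    have hL : LinearMap.ker L ≠ ⊤ := by
      intro hL
      have : (Pi.single i 1 : Fin k → ℝ) ∈ LinearMap.ker L := hL ▸ Submodule.mem_top
      simp [L, hij.symm] at this
    have := Measure.addHaar_submodule volume (LinearMap.ker L) hL
    rw [ae_iff]
    convert this using 2
    ext x
    simp [L, sub_eq_zero]
  have hdiag' : ∀ᵐ x : Fin k → ℝ, ∀ i j, i ≠ j → x i ≠ x j :=
    ae_all_iff.2 fun i => ae_all_iff.2 fun j => by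
      by_cases hij : i = j
      · exact Filter.Eventually.of_forall fun x h => absurd hij h
      · exact (hdiag i j hij).mono fun x hx _ => hx
  have hall : ∀ᵐ x : Fin k → ℝ, ∀ q : Fin k → ℚ × ℚ, (∀ i j, i ≠ j → Disjoint (I q i) (I q j)) →
      x ∈ Set.univ.pi (I q) → f x = 0 := by
    refine ae_all_iff.2 fun q => ?_
    by_cases hq : ∀ i j, i ≠ j → Disjoint (I q i) (I q j)
    · have := (ae_restrict_iff' (MeasurableSet.univ_pi fun i => measurableSet_Ioo)).1 (hbox q hq)
      filter_upwards [this] with x hx _ using hx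
    · exact Filter.Eventually.of_forall fun x h => absurd h hq
  filter_upwards [hdiag', hall] with x hx hx'
  obtain ⟨U, hU, hUd⟩ := (Set.finite_range x).t2_separation
  have hq : ∀ i, ∃ a b : ℚ, x i ∈ Set.Ioo (a : ℝ) b ∧ Set.Ioo (a : ℝ) b ⊆ U (x i) := by
    intro i
    obtain ⟨v, hv, hxv, hvU⟩ :=
      Real.isTopologicalBasis_Ioo_rat.exists_subset_of_mem_open (hU (x i)).1 (hU (x i)).2
    simp only [Set.mem_iUnion, Set.mem_singleton_iff] at hv
    obtain ⟨a, b, _, rfl⟩ := hv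
    exact ⟨a, b, hxv, hvU⟩
  choose a b hab hab' using hq
  exact hx' (fun i => (a i, b i)) (fun i j hij => (hUd (Set.mem_range_self i)
    (Set.mem_range_self j) (hx i j hij)).mono (hab' i) (hab' j)) fun i _ => hab i

/-! ### Permuting the arguments -/

lemma measurePreserving_comp_perm {k : ℕ} (σ : Equiv.Perm (Fin k)) :
    MeasurePreserving (fun x : Fin k → ℝ => fun i => x (σ i)) volume volume := by
  have := volume_measurePreserving_piCongrLeft (fun _ : Fin k => ℝ) σ.symm
  convert this using 1
  ext x i
  obtain ⟨j, rfl⟩ := σ.symm.surjective i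
  rw [MeasurableEquiv.coe_piCongrLeft, Equiv.piCongrLeft_apply_apply]
  simp

/-- The sum over all permutations of the arguments, that is `k!` times the symmetrization, as an
operator on `L²(ℝ^k)`. -/
noncomputable def permSum (k : ℕ) :
    Lp ℝ 2 (volume : Measure (Fin k → ℝ)) →L[ℝ] Lp ℝ 2 (volume : Measure (Fin k → ℝ)) :=
  ∑ σ : Equiv.Perm (Fin k),
    (Lp.compMeasurePreservingₗᵢ ℝ _ (measurePreserving_comp_perm σ)).toContinuousLinearMap

lemma permSum_apply_of_symmetric {k : ℕ} {f : (Fin k → ℝ) → ℝ}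
    (hf : ∀ (σ : Equiv.Perm (Fin k)) x, f (fun i => x (σ i)) = f x)
    {F : Lp ℝ 2 (volume : Measure (Fin k → ℝ))} (hF : F =ᵐ[volume] f) :
    permSum k F = (k.factorial : ℝ) • F := by
  have h : ∀ σ : Equiv.Perm (Fin k),
      Lp.compMeasurePreserving _ (measurePreserving_comp_perm σ) F = F := by
    intro σ
    refine Lp.ext ((Lp.coeFn_compMeasurePreserving _ _).trans ?_)
    refine ((measurePreserving_comp_perm σ).quasiMeasurePreserving.ae_eq_comp hF).trans ?_
    filter_upwards [hF] with x hx
    rw [hx]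
    exact hf σ x
  simp only [permSum, sum_apply, LinearIsometry.coe_toContinuousLinearMap]
  have h' : ∀ σ : Equiv.Perm (Fin k),
      Lp.compMeasurePreservingₗᵢ ℝ _ (measurePreserving_comp_perm σ) F = F := h
  simp [h', Fintype.card_perm, Nat.cast_smul_eq_nsmul]

/-! ### The Wiener–Itô integral -/

section WienerIto

variable {Ω : Type*} [MeasurableSpace Ω] {P : Measure Ω} {W : Set ℝ → Ω → ℝ} {k : ℕ}

/-- The generating pairs of the Wiener–Itô graph. -/
def IsBoxPair (P : Measure Ω) (W : Set ℝ → Ω → ℝ)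
    (p : Lp ℝ 2 (volume : Measure (Fin k → ℝ)) × Lp ℝ 2 P) : Prop :=
  ∃ A : Fin k → Set ℝ,
    (∀ i, MeasurableSet (A i) ∧ volume (A i) < ∞) ∧
    (∀ i j, i ≠ j → Disjoint (A i) (A j)) ∧
    p.1 =ᵐ[volume] (Set.univ.pi A).indicator (fun _ => (1 : ℝ)) ∧
    p.2 =ᵐ[P] fun ω => ∏ i, W (A i) ω

lemma wienerItoGraph_le_ker (φ : Lp ℝ 2 (volume : Measure (Fin k → ℝ)) × Lp ℝ 2 P →L[ℝ] ℝ)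
    (hφ : ∀ p, IsBoxPair P W p → φ p = 0) : wienerItoGraph P W k ≤ LinearMap.ker φ.toLinearMap := by
  refine Submodule.topologicalClosure_minimal _ (Submodule.span_le.2 fun p hp => ?_) φ.isClosed_ker
  exact hφ p hp

lemma integral_eq_zero_of_mem_wienerItoGraph (hW : IsWhiteNoise P W) (hk : 1 ≤ k)
    {p : Lp ℝ 2 (volume : Measure (Fin k → ℝ)) × Lp ℝ 2 P} (hp : p ∈ wienerItoGraph P W k) :
    ∫ ω, p.2 ω ∂P = 0 := by
  have hP := hW.gaussian.isProbabilityMeasure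
  have : Nonempty (Fin k) := ⟨⟨0, hk⟩⟩
  let one : Lp ℝ 2 P := indicatorConstLp 2 MeasurableSet.univ (measure_ne_top P _) (1 : ℝ)
  have hone : ∀ X : Lp ℝ 2 P, inner ℝ one X = ∫ ω, X ω ∂P := by
    intro X
    rw [L2.inner_indicatorConstLp_one]
    simp
  have := wienerItoGraph_le_ker (P := P) (W := W)
    ((innerSL ℝ one).comp (ContinuousLinearMap.snd ℝ _ _)) (fun q hq => ?_) hp
  · rw [← hone]
    exact this
  · obtain ⟨A, hA, hAd, -, h2⟩ := hq
    change inner ℝ one q.2 = 0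
    rw [hone, integral_congr_ae h2]
    exact hW.integral_prod_eq_zero (fun i => (hA i).1) (fun i => (hA i).2) hAd

lemma inner_boxPair (hW : IsWhiteNoise P W)
    {p q : Lp ℝ 2 (volume : Measure (Fin k → ℝ)) × Lp ℝ 2 P} (hp : IsBoxPair P W p)
    (hq : IsBoxPair P W q) : inner ℝ p.2 q.2 = inner ℝ p.1 (permSum k q.1) := by
  obtain ⟨A, hA, hAd, hA1, hA2⟩ := hp
  obtain ⟨B, hB, hBd, hB1, hB2⟩ := hq
  have hAm : MeasurableSet (Set.univ.pi A) := MeasurableSet.univ_pi fun i => (hA i).1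
  have hl : inner ℝ p.2 q.2 = ∑ σ : Equiv.Perm (Fin k), ∏ i, volume.real (A i ∩ B (σ i)) := by
    rw [← hW.integral_prod_mul_prod (fun i => (hA i).1) (fun i => (hA i).2) hAd
      (fun i => (hB i).1) (fun i => (hB i).2) hBd, L2.inner_def]
    refine integral_congr_ae ?_
    filter_upwards [hA2, hB2] with ω h1 h2
    simp [h1, h2, mul_comm]
  have hσ : ∀ σ : Equiv.Perm (Fin k),
      inner ℝ p.1 (Lp.compMeasurePreservingₗᵢ ℝ _ (measurePreserving_comp_perm σ) q.1) =
        ∏ i, volume.real (A i ∩ B (σ.symm i)) := by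
    intro σ
    have h3 : (Lp.compMeasurePreservingₗᵢ ℝ _ (measurePreserving_comp_perm σ) q.1 : _ → ℝ)
        =ᵐ[volume] fun x => (Set.univ.pi B).indicator (fun _ => (1 : ℝ)) fun i => x (σ i) :=
      (Lp.coeFn_compMeasurePreserving _ _).trans
        ((measurePreserving_comp_perm σ).quasiMeasurePreserving.ae_eq_comp hB1)
    rw [L2.inner_def]
    have h4 : ∫ x, (Set.univ.pi fun i => A i ∩ B (σ.symm i)).indicator (fun _ => (1 : ℝ)) x =
        ∏ i, volume.real (A i ∩ B (σ.symm i)) := by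
      rw [integral_indicator_const _
        (MeasurableSet.univ_pi fun i => (hA i).1.inter (hB _).1), smul_eq_mul, mul_one,
        measureReal_def, volume_pi, Measure.pi_pi, ENNReal.toReal_prod]
      rfl
    rw [← h4]
    refine integral_congr_ae ?_
    filter_upwards [hA1, h3] with x hx1 hx3
    rw [hx1, hx3]
    have hmem : (x ∈ Set.univ.pi fun i => A i ∩ B (σ.symm i)) ↔
        x ∈ Set.univ.pi A ∧ (fun i => x (σ i)) ∈ Set.univ.pi B := by
      simp only [Set.mem_univ_pi, Set.mem_inter_iff, forall_and]
      refine and_congr_right fun _ => ⟨fun h i => by simpa using h (σ i), fun h i => by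
        simpa using h (σ.symm i)⟩
    by_cases h1 : x ∈ Set.univ.pi A <;> by_cases h2 : (fun i => x (σ i)) ∈ Set.univ.pi B <;>
      simp only [Set.indicator, hmem, h1, h2] <;> simp
  rw [hl, permSum, sum_apply, inner_sum]
  simp only [LinearIsometry.coe_toContinuousLinearMap, hσ]
  exact (Equiv.sum_comp (Equiv.inv (Equiv.Perm (Fin k)))
    fun σ : Equiv.Perm (Fin k) => ∏ i, volume.real (A i ∩ B (σ i))).symm

/-- The Itô isometry on the whole graph, by bilinearity and continuity. -/
lemma inner_wienerItoGraph (hW : IsWhiteNoise P W)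
    {p q : Lp ℝ 2 (volume : Measure (Fin k → ℝ)) × Lp ℝ 2 P} (hp : p ∈ wienerItoGraph P W k)
    (hq : q ∈ wienerItoGraph P W k) : inner ℝ p.2 q.2 = inner ℝ p.1 (permSum k q.1) := by
  have h1 : ∀ p', IsBoxPair P W p' → inner ℝ p'.2 q.2 = inner ℝ p'.1 (permSum k q.1) := by
    intro p' hp'
    have := wienerItoGraph_le_ker (P := P) (W := W)
      ((innerSL ℝ p'.2).comp (ContinuousLinearMap.snd ℝ _ _) -
        ((innerSL ℝ p'.1).comp (permSum k)).comp (ContinuousLinearMap.fst ℝ _ _))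
      (fun q' hq' => by simpa [sub_eq_zero] using inner_boxPair hW hp' hq') hq
    simpa [sub_eq_zero] using this
  have := wienerItoGraph_le_ker (P := P) (W := W)
    ((innerSL ℝ q.2).comp (ContinuousLinearMap.snd ℝ _ _) -
      (innerSL ℝ (permSum k q.1)).comp (ContinuousLinearMap.fst ℝ _ _))
    (fun p' hp' => by
      simpa [sub_eq_zero, real_inner_comm] using h1 p' hp') hp
  simpa [sub_eq_zero, real_inner_comm] using this

/-- Every square integrable function has a Wiener–Itô integral: by the isometry the projection of
the graph to `L²(ℝ^k)` has closed range, and the range contains the total set of boxes. -/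
lemma exists_mem_wienerItoGraph (hW : IsWhiteNoise P W)
    (F : Lp ℝ 2 (volume : Measure (Fin k → ℝ))) :
    ∃ X : Lp ℝ 2 P, (F, X) ∈ wienerItoGraph P W k := by
  let S := wienerItoGraph P W k
  have hcomp : CompleteSpace S := (Submodule.isClosed_topologicalClosure _).completeSpace_coe
  let π : S →L[ℝ] Lp ℝ 2 (volume : Measure (Fin k → ℝ)) :=
    (ContinuousLinearMap.fst ℝ _ _).comp S.subtypeL
  have hbound : ∀ p : S, ‖p‖ ≤ (1 + ‖permSum k‖) * ‖π p‖ := by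
    intro p
    have hT := norm_nonneg (permSum k)
    have h0 := norm_nonneg p.1.1
    have hsq : ‖p.1.2‖ ^ 2 ≤ ((1 + ‖permSum k‖) * ‖p.1.1‖) ^ 2 := by
      rw [← real_inner_self_eq_norm_sq, inner_wienerItoGraph hW p.2 p.2]
      calc inner ℝ p.1.1 (permSum k p.1.1) ≤ ‖p.1.1‖ * ‖permSum k p.1.1‖ :=
            real_inner_le_norm _ _
        _ ≤ ‖p.1.1‖ * (‖permSum k‖ * ‖p.1.1‖) := by
            gcongr
            exact (permSum k).le_opNorm _
        _ ≤ ((1 + ‖permSum k‖) * ‖p.1.1‖) ^ 2 := by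
            nlinarith [mul_nonneg hT (sq_nonneg ‖p.1.1‖), sq_nonneg ‖p.1.1‖,
              mul_nonneg (mul_nonneg hT hT) (sq_nonneg ‖p.1.1‖)]
    have h2 : ‖p.1.2‖ ≤ (1 + ‖permSum k‖) * ‖p.1.1‖ := le_of_sq_le_sq hsq (by positivity)
    refine max_le ?_ h2
    change ‖p.1.1‖ ≤ (1 + ‖permSum k‖) * ‖p.1.1‖
    nlinarith
  have hanti : AntilipschitzWith ⟨1 + ‖permSum k‖, by positivity⟩ π :=
    ContinuousLinearMap.antilipschitz_of_bound π hbound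
  have hclosed : IsClosed (Set.range π) := hanti.isClosed_range π.uniformContinuous
  have hbot : (LinearMap.range π.toLinearMap)ᗮ = ⊥ := by
    refine (Submodule.eq_bot_iff _).2 fun G hG => ?_
    refine Lp.ext ?_
    refine (ae_eq_zero_of_forall_setIntegral_box_eq_zero (Lp.memLp G) ?_).trans
      (Lp.coeFn_zero ℝ 2 volume).symm
    intro A hA hAd
    have hm : MeasurableSet (Set.univ.pi A) := MeasurableSet.univ_pi fun i => (hA i).1
    have hv : volume (Set.univ.pi A) ≠ ∞ := by
      rw [volume_pi, Measure.pi_pi]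
      exact (ENNReal.prod_lt_top fun i _ => (hA i).2).ne
    have hL := hW.memLp_prod (fun i => (hA i).1) (fun i => (hA i).2)
    have hmem : ((indicatorConstLp 2 hm hv (1 : ℝ),
        hL.toLp _) :
        Lp ℝ 2 (volume : Measure (Fin k → ℝ)) × Lp ℝ 2 P) ∈ S :=
      Submodule.le_topologicalClosure _ (Submodule.subset_span
        ⟨A, hA, hAd, indicatorConstLp_coeFn (hs := hm) (hμs := hv), hL.coeFn_toLp⟩)
    rw [← L2.inner_indicatorConstLp_one (𝕜 := ℝ) hm hv G]
    exact (Submodule.mem_orthogonal _ _).1 hG _ ⟨⟨_, hmem⟩, rfl⟩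
  have htop : (LinearMap.range π.toLinearMap).topologicalClosure = ⊤ :=
    Submodule.topologicalClosure_eq_top_iff.2 hbot
  have hF : F ∈ (LinearMap.range π.toLinearMap).topologicalClosure := htop ▸ Submodule.mem_top
  have hF' : F ∈ Set.range π := by
    have : F ∈ closure (Set.range π) := hF
    rwa [hclosed.closure_eq] at this
  obtain ⟨p, rfl⟩ := hF'
  exact ⟨p.1.2, p.2⟩

lemma exists_wienerItoIntegral_spec (hW : IsWhiteNoise P W) {f : (Fin k → ℝ) → ℝ}
    (hf : MemLp f 2 volume) :
    ∃ X : Lp ℝ 2 P, ∃ F : Lp ℝ 2 (volume : Measure (Fin k → ℝ)), wienerItoIntegral P W f = X ∧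
      F =ᵐ[volume] f ∧ (F, X) ∈ wienerItoGraph P W k := by
  obtain ⟨Y, hY⟩ := exists_mem_wienerItoGraph hW (hf.toLp f)
  have h : ∃ X : Lp ℝ 2 P, ∃ F : Lp ℝ 2 (volume : Measure (Fin k → ℝ)),
      F =ᵐ[volume] f ∧ (F, X) ∈ wienerItoGraph P W k := ⟨Y, _, hf.coeFn_toLp, hY⟩
  obtain ⟨F, hF⟩ := h.choose_spec
  exact ⟨h.choose, F, by rw [wienerItoIntegral, dif_pos h], hF⟩

lemma memLp_wienerItoIntegral (hW : IsWhiteNoise P W) {f : (Fin k → ℝ) → ℝ}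
    (hf : MemLp f 2 volume) : MemLp (wienerItoIntegral P W f) 2 P := by
  obtain ⟨X, F, h, -⟩ := exists_wienerItoIntegral_spec hW hf
  rw [h]
  exact Lp.memLp X

lemma integral_wienerItoIntegral (hW : IsWhiteNoise P W) (hk : 1 ≤ k) {f : (Fin k → ℝ) → ℝ}
    (hf : MemLp f 2 volume) : ∫ ω, wienerItoIntegral P W f ω ∂P = 0 := by
  obtain ⟨X, F, h, -, hX⟩ := exists_wienerItoIntegral_spec hW hf
  rw [h]
  exact integral_eq_zero_of_mem_wienerItoGraph hW hk hX

/-- The Itô isometry for a symmetric second argument. -/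
lemma integral_wienerItoIntegral_mul (hW : IsWhiteNoise P W) {f g : (Fin k → ℝ) → ℝ}
    (hf : MemLp f 2 volume) (hg : MemLp g 2 volume)
    (hsymm : ∀ (σ : Equiv.Perm (Fin k)) x, g (fun i => x (σ i)) = g x) :
    ∫ ω, wienerItoIntegral P W f ω * wienerItoIntegral P W g ω ∂P =
      (k.factorial : ℝ) * ∫ x, f x * g x := by
  obtain ⟨X, F, h, hF, hX⟩ := exists_wienerItoIntegral_spec hW hf
  obtain ⟨Y, G, h', hG, hY⟩ := exists_wienerItoIntegral_spec hW hg
  have := inner_wienerItoGraph hW hX hY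
  rw [permSum_apply_of_symmetric hsymm hG, inner_smul_right, L2.inner_def, L2.inner_def] at this
  rw [h, h']
  have hFG : ∫ x, inner ℝ (F x) (G x) = ∫ x, f x * g x := by
    refine integral_congr_ae ?_
    filter_upwards [hF, hG] with x h1 h2
    simp [h1, h2, mul_comm]
  rw [← hFG, ← this]
  simp [mul_comm]

end WienerIto

/-! ### Integrability of the filter -/

lemma measurable_filterFun (β t : ℝ) : Measurable (filterFun β t) := by
  unfold filterFun
  fun_prop

lemma intervalIntegrable_max_rpow {r p : ℝ} (hr : r ≠ 0) (hp : 0 < p) (hrp : -1 < r * p)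
    (a b : ℝ) : IntervalIntegrable (fun y : ℝ => ((max y 0) ^ r) ^ p) volume a b := by
  have h : (fun y : ℝ => ((max y 0) ^ r) ^ p) = (Set.Ioi 0).indicator fun y => y ^ (r * p) := by
    ext y
    by_cases hy : 0 < y
    · rw [Set.indicator_of_mem (Set.mem_Ioi.2 hy), max_eq_left hy.le, Real.rpow_mul hy.le]
    · rw [Set.indicator_of_notMem (by simpa using hy), max_eq_right (not_lt.1 hy),
        Real.zero_rpow hr, Real.zero_rpow hp.ne']
  rw [h, intervalIntegrable_iff]
  exact (intervalIntegrable_iff.1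
    (intervalIntegral.intervalIntegrable_rpow' hrp)).indicator measurableSet_Ioi

lemma filterFun_eq_zero {β t u : ℝ} (hβ : β ≠ 0) (hu : |t| ≤ u) : filterFun β t u = 0 := by
  have h1 : t - u ≤ 0 := by linarith [le_abs_self t]
  have h2 : -u ≤ 0 := by linarith [abs_nonneg t]
  simp [filterFun, max_eq_right h1, max_eq_right h2, Real.zero_rpow hβ]

/-- Far out on the negative half line the filter decays like `|u|^(β - 1)`. -/
lemma abs_filterFun_le {β t u : ℝ} (hβ : β ≠ 0) (hβ1 : β < 1) (hu : u < -(2 * |t| + 1)) :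
    |filterFun β t u| ≤ |t| * (1 / 2) ^ (β - 1) * (-u) ^ (β - 1) := by
  have ht := abs_nonneg t
  have h1 : 0 < -u := by linarith
  have h2 : -u / 2 ≤ t - u := by linarith [neg_abs_le t]
  have hmv := (convex_Ici (-u / 2)).norm_image_sub_le_of_norm_deriv_le (𝕜 := ℝ)
    (f := fun y : ℝ => y ^ β) (C := |β| * (-u / 2) ^ (β - 1)) (x := -u) (y := t - u)
    (fun y hy => (Real.hasDerivAt_rpow_const (Or.inl (by
      have : -u / 2 ≤ y := hy
      linarith))).differentiableAt)
    (fun y hy => by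
      have hy' : -u / 2 ≤ y := hy
      have hy0 : 0 < y := by linarith
      rw [Real.deriv_rpow_const, norm_mul, Real.norm_eq_abs, Real.norm_eq_abs,
        abs_of_pos (Real.rpow_pos_of_pos hy0 _)]
      exact mul_le_mul_of_nonneg_left
        (Real.rpow_le_rpow_of_nonpos (by linarith) hy' (by linarith)) (abs_nonneg β))
    (by simp only [Set.mem_Ici]; linarith) (by simpa using h2)
  have h3 : t - u - -u = t := by ring
  rw [h3, Real.norm_eq_abs, Real.norm_eq_abs] at hmv
  have h4 : (-u / 2) ^ (β - 1) = (1 / 2) ^ (β - 1) * (-u) ^ (β - 1) := by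
    rw [← Real.mul_rpow (by norm_num) h1.le]
    congr 1
    ring
  rw [h4] at hmv
  rw [filterFun, max_eq_left (by linarith), max_eq_left h1.le, abs_mul, abs_div, abs_one]
  have hb : 0 < |β| := abs_pos.2 hβ
  calc 1 / |β| * |(t - u) ^ β - (-u) ^ β|
      ≤ 1 / |β| * (|β| * ((1 / 2) ^ (β - 1) * (-u) ^ (β - 1)) * |t|) := by gcongr
    _ = |t| * (1 / 2) ^ (β - 1) * (-u) ^ (β - 1) := by field_simp

lemma integrableOn_Iio_neg_rpow {a R : ℝ} (ha : a < -1) (hR : 0 < R) :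
    IntegrableOn (fun u : ℝ => (-u) ^ a) (Set.Iio (-R)) := by
  have h := ((Measure.measurePreserving_neg (volume : Measure ℝ)).integrableOn_comp_preimage
    (Homeomorph.neg ℝ).measurableEmbedding).2 (integrableOn_Ioi_rpow_of_lt ha hR)
  simpa [Function.comp_def] using h

lemma integrable_abs_filterFun_rpow {β p : ℝ} (hβ : β ≠ 0) (hp : 1 ≤ p) (h1 : -1 < β * p)
    (h2 : (β - 1) * p < -1) (t : ℝ) : Integrable fun u => |filterFun β t u| ^ p := by
  have hp0 : 0 < p := by linarith
  have hβ1 : β < 1 := by nlinarith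
  have hmeas : Measurable fun u => |filterFun β t u| ^ p :=
    (measurable_filterFun β t).abs.pow_const p
  set R := 2 * |t| + 1 with hR
  have hR0 : 0 < R := by positivity
  have hfar : IntegrableOn (fun u => |filterFun β t u| ^ p) (Set.Iio (-R)) := by
    refine ((integrableOn_Iio_neg_rpow h2 hR0).const_mul
      ((|t| * (1 / 2) ^ (β - 1)) ^ p)).mono' hmeas.aestronglyMeasurable ?_
    refine (ae_restrict_iff' measurableSet_Iio).2 (Filter.Eventually.of_forall fun u hu => ?_)
    have hu0 : 0 ≤ -u := by linarith [Set.mem_Iio.1 hu]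
    rw [Real.norm_of_nonneg (by positivity), Real.rpow_mul hu0,
      ← Real.mul_rpow (by positivity) (by positivity)]
    exact Real.rpow_le_rpow (abs_nonneg _) (abs_filterFun_le hβ hβ1 hu) hp0.le
  have hmid : IntegrableOn (fun u => |filterFun β t u| ^ p) (Set.Ioc (-R - 1) |t|) := by
    have hle : -R - 1 ≤ |t| := by linarith [abs_nonneg t]
    have hi : ∀ c, IntegrableOn (fun u : ℝ => ((max (c - u) 0) ^ β) ^ p)
        (Set.Ioc (-R - 1) |t|) := by
      intro c
      rw [← intervalIntegrable_iff_integrableOn_Ioc_of_le hle]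
      have := (intervalIntegrable_max_rpow hβ hp0 h1 (c - (-R - 1)) (c - |t|)).comp_sub_left c
      simpa using this
    refine ((((hi t).add (hi 0)).const_mul ((|1 / β| * 2) ^ p))).mono'
      hmeas.aestronglyMeasurable (Filter.Eventually.of_forall fun u => ?_)
    rw [Real.norm_of_nonneg (by positivity)]
    set a := (max (t - u) 0) ^ β with ha
    set b := (max (0 - u) 0) ^ β with hb
    have ha0 : 0 ≤ a := Real.rpow_nonneg (le_max_right _ _) _
    have hb0 : 0 ≤ b := Real.rpow_nonneg (le_max_right _ _) _
    have hf : |filterFun β t u| = |1 / β| * |a - b| := by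
      rw [filterFun, abs_mul, ha, hb, zero_sub]
    have hab : |a - b| ≤ 2 * max a b := by
      rw [abs_le]
      constructor <;> linarith [le_max_left a b, le_max_right a b]
    have hm0 : 0 ≤ max a b := ha0.trans (le_max_left _ _)
    calc |filterFun β t u| ^ p ≤ ((|1 / β| * 2) * max a b) ^ p := by
          rw [hf, mul_assoc]
          gcongr
      _ = (|1 / β| * 2) ^ p * (max a b) ^ p := Real.mul_rpow (by positivity) hm0
      _ ≤ (|1 / β| * 2) ^ p * (a ^ p + b ^ p) := by
          gcongr
          rcases max_choice a b with h | h <;> rw [h]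
          · linarith [Real.rpow_nonneg hb0 p]
          · linarith [Real.rpow_nonneg ha0 p]
  have hright : IntegrableOn (fun u => |filterFun β t u| ^ p) (Set.Ioi |t|) := by
    refine IntegrableOn.congr_fun integrableOn_zero (fun u hu => ?_) measurableSet_Ioi
    simp [filterFun_eq_zero hβ (le_of_lt hu), Real.zero_rpow hp0.ne']
  rw [← integrableOn_univ]
  refine ((hfar.union hmid).union hright).mono_set fun u _ => ?_
  by_cases hu : u < -R
  · exact Or.inl (Or.inl hu)
  · by_cases hu' : u ≤ |t|
    · exact Or.inl (Or.inr ⟨by linarith, hu'⟩)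
    · exact Or.inr (not_le.1 hu')

/-! ### Absolute convergence of the double integral -/

lemma integrable_abs_rpow_mul_exp {c m : ℝ} (hc : -1 < c) (hm : 0 < m) :
    Integrable fun w : ℝ => |w| ^ c * Real.exp (-m * |w|) := by
  have h : IntegrableOn (fun w : ℝ => |w| ^ c * Real.exp (-m * |w|)) (Set.Ioi 0) := by
    refine (integrableOn_rpow_mul_exp_neg_mul_rpow hc one_pos hm).congr_fun (fun w hw => ?_)
      measurableSet_Ioi
    simp [abs_of_pos (Set.mem_Ioi.1 hw)]
  have h' : IntegrableOn (fun w : ℝ => |w| ^ c * Real.exp (-m * |w|)) (Set.Iio 0) := by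
    have := ((Measure.measurePreserving_neg (volume : Measure ℝ)).integrableOn_comp_preimage
      (Homeomorph.neg ℝ).measurableEmbedding).2 h
    simpa [Function.comp_def] using this
  rw [← integrableOn_univ, ← Set.Iic_union_Ioi (a := (0 : ℝ))]
  exact ((integrableOn_Iic_iff_integrableOn_Iio (by finiteness)).2 h').union h

/-- Young's inequality for the trilinear form `∫∫ f(u) h(v) κ(u - v)` with exponents
`1/(1-θ), 1/(1-θ), 1/(2θ)`, as a statement about absolute convergence. The integrand is the
weighted geometric mean of three integrable functions. -/
lemma integrable_mul_mul_comp_sub {f h κ : ℝ → ℝ} {θ : ℝ} (hθ : 0 < θ) (hθ' : θ < 1 / 2)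
    (hfm : Measurable f) (hhm : Measurable h) (hκm : Measurable κ)
    (hf : Integrable fun u => |f u| ^ (1 / (1 - θ)))
    (hh : Integrable fun u => |h u| ^ (1 / (1 - θ)))
    (hκ : Integrable fun w => |κ w| ^ (1 / (2 * θ))) :
    Integrable fun p : ℝ × ℝ => f p.1 * h p.2 * κ (p.1 - p.2) := by
  have hθ1 : 1 - θ ≠ 0 := by linarith
  have i1 : Integrable fun p : ℝ × ℝ => |f p.1| ^ (1 / (1 - θ)) * |h p.2| ^ (1 / (1 - θ)) :=
    hf.mul_prod hh
  have i3 : Integrable fun p : ℝ × ℝ =>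
      |h p.2| ^ (1 / (1 - θ)) * |κ (p.1 - p.2)| ^ (1 / (2 * θ)) :=
    hh.convolution_integrand (ContinuousLinearMap.mul ℝ ℝ) hκ
  have hκ' : Integrable fun w => |κ (-w)| ^ (1 / (2 * θ)) := hκ.comp_neg
  have i2 : Integrable fun p : ℝ × ℝ =>
      |f p.1| ^ (1 / (1 - θ)) * |κ (p.1 - p.2)| ^ (1 / (2 * θ)) := by
    have := (hf.convolution_integrand (μ := volume) (ν := volume)
      (ContinuousLinearMap.mul ℝ ℝ) hκ').swap
    simpa [Function.comp_def, Measure.volume_eq_prod] using this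
  refine (((i1.const_mul (1 - 2 * θ)).add (i2.const_mul θ)).add (i3.const_mul θ)).mono' ?_
    (Filter.Eventually.of_forall fun p => ?_)
  · exact (((hfm.comp measurable_fst).mul (hhm.comp measurable_snd)).mul
      (hκm.comp (measurable_fst.sub measurable_snd))).aestronglyMeasurable
  · have key := Real.geom_mean_le_arith_mean3_weighted (w₁ := 1 - 2 * θ) (w₂ := θ) (w₃ := θ)
      (p₁ := |f p.1| ^ (1 / (1 - θ)) * |h p.2| ^ (1 / (1 - θ)))
      (p₂ := |f p.1| ^ (1 / (1 - θ)) * |κ (p.1 - p.2)| ^ (1 / (2 * θ)))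
      (p₃ := |h p.2| ^ (1 / (1 - θ)) * |κ (p.1 - p.2)| ^ (1 / (2 * θ)))
      (by linarith) hθ.le hθ.le (by positivity) (by positivity) (by positivity) (by ring)
    refine le_trans (le_of_eq ?_) key
    have e : ∀ {a r : ℝ}, 0 ≤ a → r ≠ 0 → ∀ s, (a ^ (1 / r)) ^ s = a ^ (s / r) := by
      intro a r ha hr s
      rw [← Real.rpow_mul ha]
      congr 1
      ring
    have e1 : ∀ {a : ℝ}, 0 ≤ a → a ^ ((1 - 2 * θ) / (1 - θ)) * a ^ (θ / (1 - θ)) = a := by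
      intro a ha
      rw [← Real.rpow_add_of_nonneg ha (div_nonneg (by linarith) (by linarith))
        (div_nonneg hθ.le (by linarith)), ← add_div,
        show 1 - 2 * θ + θ = 1 - θ by ring, div_self hθ1, Real.rpow_one]
    have e2 : ∀ {a : ℝ}, 0 ≤ a → a ^ (θ / (2 * θ)) * a ^ (θ / (2 * θ)) = a := by
      intro a ha
      rw [← Real.rpow_add_of_nonneg ha (by positivity) (by positivity), ← add_div,
        show θ + θ = 2 * θ by ring, div_self (by positivity), Real.rpow_one]
    rw [Real.mul_rpow (by positivity) (by positivity),
      Real.mul_rpow (by positivity) (by positivity),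
      Real.mul_rpow (by positivity) (by positivity), e (abs_nonneg _) hθ1, e (abs_nonneg _) hθ1,
      e (abs_nonneg _) hθ1, e (abs_nonneg _) hθ1, e (abs_nonneg _) (by positivity),
      norm_mul, norm_mul, Real.norm_eq_abs, Real.norm_eq_abs, Real.norm_eq_abs]
    conv_lhs => rw [← e1 (abs_nonneg (f p.1)), ← e1 (abs_nonneg (h p.2)),
      ← e2 (abs_nonneg (κ (p.1 - p.2)))]
    ring

/-- Absolute convergence for the tempered power kernel. The exponent `θ` lies slightly above
`-d/2`; the conditions on `β` are exactly what puts both filters into `L^(1/(1-θ))`. -/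
lemma integrable_filterFun_mul_filterFun {β d m : ℝ} (hβ : β ≠ 0) (hd : -1 < d) (hd' : d < 0)
    (hm : 0 < m) (h1 : -d / 2 - 1 < β) (h2 : β < -d / 2) (s t : ℝ) :
    Integrable fun p : ℝ × ℝ => filterFun β s p.1 * filterFun β t p.2 *
      (|p.1 - p.2| ^ d * Real.exp (-m * |p.1 - p.2|)) := by
  obtain ⟨θ, hθ1, hθ2⟩ := exists_between (show -d / 2 < min (1 / 2) (β + 1) from
    lt_min (by linarith) (by linarith))
  have hθ0 : 0 < θ := by linarith
  have hθ3 : θ < 1 / 2 := hθ2.trans_le (min_le_left _ _)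
  have hθ4 : θ < β + 1 := hθ2.trans_le (min_le_right _ _)
  have h1θ : 0 < 1 - θ := by linarith
  have hl : ∀ r, Integrable fun u => |filterFun β r u| ^ (1 / (1 - θ)) := fun r =>
    integrable_abs_filterFun_rpow hβ (by rw [le_div_iff₀ h1θ]; linarith)
      (by rw [mul_one_div, lt_div_iff₀ h1θ]; linarith)
      (by rw [mul_one_div, div_lt_iff₀ h1θ]; linarith) r
  refine integrable_mul_mul_comp_sub (κ := fun w => |w| ^ d * Real.exp (-m * |w|)) hθ0 hθ3
    (measurable_filterFun β s) (measurable_filterFun β t) (by fun_prop) (hl s) (hl t) ?_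
  have := integrable_abs_rpow_mul_exp (c := d * (1 / (2 * θ))) (m := m * (1 / (2 * θ)))
    (by rw [mul_one_div, lt_div_iff₀ (by positivity)]; linarith) (by positivity)
  refine this.congr (Filter.Eventually.of_forall fun w => ?_)
  simp only
  rw [abs_of_nonneg (show 0 ≤ |w| ^ d * Real.exp (-m * |w|) by positivity),
    Real.mul_rpow (by positivity) (by positivity), ← Real.rpow_mul (abs_nonneg w), ← Real.exp_mul]
  congr 2
  ring

/-! ### The one-dimensional factor -/

/-- The one-dimensional factor `y₊^γ e^{-λ y}` of the tempered kernel. -/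
noncomputable def temperedPower (γ lam : ℝ) : ℝ → ℝ :=
  (Set.Ioi 0).indicator fun y => y ^ γ * Real.exp (-lam * y)

lemma measurable_temperedPower (γ lam : ℝ) : Measurable (temperedPower γ lam) :=
  Measurable.indicator (by fun_prop) measurableSet_Ioi

lemma temperedPower_nonneg (γ lam y : ℝ) : 0 ≤ temperedPower γ lam y :=
  Set.indicator_nonneg (fun _ hy => mul_nonneg (Real.rpow_nonneg (le_of_lt hy) _)
    (Real.exp_nonneg _)) y

lemma integrableOn_rpow_mul_one_add_rpow {γ : ℝ} (h1 : -1 < γ) (h2 : γ < -1 / 2) :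
    IntegrableOn (fun x : ℝ => x ^ γ * (1 + x) ^ γ) (Set.Ioi 0) := by
  have hmeas : Measurable fun x : ℝ => x ^ γ * (1 + x) ^ γ := by fun_prop
  have hA : IntegrableOn (fun x : ℝ => x ^ γ * (1 + x) ^ γ) (Set.Ioc 0 1) := by
    have : IntegrableOn (fun x : ℝ => x ^ γ) (Set.Ioc 0 1) :=
      (intervalIntegrable_iff_integrableOn_Ioc_of_le zero_le_one).1
        (intervalIntegral.intervalIntegrable_rpow' h1)
    refine this.mono' hmeas.aestronglyMeasurable
      ((ae_restrict_iff' measurableSet_Ioc).2 (Filter.Eventually.of_forall fun x hx => ?_))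
    have hx0 : 0 < x := hx.1
    rw [Real.norm_of_nonneg (by positivity)]
    exact mul_le_of_le_one_right (by positivity)
      (Real.rpow_le_one_of_one_le_of_nonpos (by linarith) (by linarith))
  have hB : IntegrableOn (fun x : ℝ => x ^ γ * (1 + x) ^ γ) (Set.Ioi 1) := by
    refine (integrableOn_Ioi_rpow_of_lt (a := γ + γ) (by linarith) one_pos).mono'
      hmeas.aestronglyMeasurable
      ((ae_restrict_iff' measurableSet_Ioi).2 (Filter.Eventually.of_forall fun x hx => ?_))
    have hx0 : (0 : ℝ) < x := one_pos.trans hx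
    rw [Real.norm_of_nonneg (by positivity), Real.rpow_add hx0]
    gcongr ?_ * ?_
    exact Real.rpow_le_rpow_of_nonpos hx0 (by linarith) (by linarith)
  rw [← Set.Ioc_union_Ioi_eq_Ioi (zero_le_one' ℝ)]
  exact hA.union hB

lemma exp_neg_mul_le_one {lam w x : ℝ} (hlam : 0 < lam) (hw : 0 ≤ w) (hx : 0 < x) :
    Real.exp (-2 * lam * w * x) ≤ 1 := by
  rw [Real.exp_le_one_iff]
  have : 0 ≤ lam * w * x := by positivity
  linarith

lemma integrableOn_temperedBeta {γ lam w : ℝ} (h1 : -1 < γ) (h2 : γ < -1 / 2) (hlam : 0 < lam)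
    (hw : 0 ≤ w) : IntegrableOn
      (fun x : ℝ => x ^ γ * (1 + x) ^ γ * Real.exp (-2 * lam * w * x)) (Set.Ioi 0) := by
  refine (integrableOn_rpow_mul_one_add_rpow h1 h2).mono' (by fun_prop)
    ((ae_restrict_iff' measurableSet_Ioi).2 (Filter.Eventually.of_forall fun x hx => ?_))
  have hx0 : (0 : ℝ) < x := hx
  rw [Real.norm_of_nonneg (by positivity)]
  exact mul_le_of_le_one_right (by positivity) (exp_neg_mul_le_one hlam hw hx0)

/-- The Laplace type integral `∫₀^∞ x^γ (1+x)^γ e^{-2λwx} dx`. -/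
noncomputable def temperedBeta (γ lam w : ℝ) : ℝ :=
  ∫ x in Set.Ioi (0 : ℝ), x ^ γ * (1 + x) ^ γ * Real.exp (-2 * lam * w * x)

lemma temperedBeta_nonneg (γ lam w : ℝ) : 0 ≤ temperedBeta γ lam w :=
  setIntegral_nonneg measurableSet_Ioi fun x hx => by
    have hx0 : (0 : ℝ) < x := hx
    positivity

lemma temperedBeta_le {γ lam w : ℝ} (h1 : -1 < γ) (h2 : γ < -1 / 2) (hlam : 0 < lam)
    (hw : 0 ≤ w) :
    temperedBeta γ lam w ≤ ∫ x in Set.Ioi (0 : ℝ), x ^ γ * (1 + x) ^ γ :=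
  setIntegral_mono_on (integrableOn_temperedBeta h1 h2 hlam hw)
    (integrableOn_rpow_mul_one_add_rpow h1 h2) measurableSet_Ioi fun x hx => by
      have hx0 : (0 : ℝ) < x := hx
      exact mul_le_of_le_one_right (by positivity) (exp_neg_mul_le_one hlam hw hx0)

lemma temperedPower_mul_add_of_pos {γ lam w x : ℝ} (hw : 0 < w) (hx : 0 < x) :
    temperedPower γ lam (w * x) * temperedPower γ lam (w + w * x) =
      w ^ (2 * γ) * Real.exp (-lam * w) *
        (x ^ γ * (1 + x) ^ γ * Real.exp (-2 * lam * w * x)) := by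
  have e : w + w * x = w * (1 + x) := by ring
  rw [temperedPower, Set.indicator_of_mem (Set.mem_Ioi.2 (by positivity)),
    Set.indicator_of_mem (Set.mem_Ioi.2 (by positivity)), e, Real.mul_rpow hw.le hx.le,
    Real.mul_rpow hw.le (by positivity), two_mul γ, Real.rpow_add hw,
    show -2 * lam * w * x = -lam * (w * x) + -lam * (w * x) by ring,
    show -lam * (w * (1 + x)) = -lam * w + -lam * (w * x) by ring, Real.exp_add, Real.exp_add]
  ring

lemma temperedPower_autocorrelation_of_pos {γ lam w : ℝ} (h1 : -1 < γ) (h2 : γ < -1 / 2)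
    (hlam : 0 < lam) (hw : 0 < w) :
    Integrable (fun y => temperedPower γ lam y * temperedPower γ lam (w + y)) ∧
    ∫ y, temperedPower γ lam y * temperedPower γ lam (w + y) =
      w ^ (2 * γ + 1) * Real.exp (-lam * w) * temperedBeta γ lam w := by
  set G : ℝ → ℝ := fun y => temperedPower γ lam y * temperedPower γ lam (w + y) with hG
  have hind : (Set.Ioi (0 : ℝ)).indicator G = G := by
    ext y
    by_cases hy : y ∈ Set.Ioi (0 : ℝ)
    · rw [Set.indicator_of_mem hy]
    · rw [Set.indicator_of_notMem hy]
      simp only [hG]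
      rw [temperedPower, Set.indicator_of_notMem hy, zero_mul]
  have hscale : Set.EqOn (fun x => w ^ (2 * γ) * Real.exp (-lam * w) *
      (x ^ γ * (1 + x) ^ γ * Real.exp (-2 * lam * w * x))) (fun x => G (w * x)) (Set.Ioi 0) :=
    fun x hx => (temperedPower_mul_add_of_pos hw hx).symm
  constructor
  · rw [← hind, integrable_indicator_iff measurableSet_Ioi]
    have := (integrableOn_Ioi_comp_mul_left_iff G 0 hw).1
      (IntegrableOn.congr_fun ((integrableOn_temperedBeta h1 h2 hlam hw.le).const_mul _) hscale
        measurableSet_Ioi)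
    simpa using this
  · have hi := integral_comp_mul_left_Ioi G 0 hw
    rw [← setIntegral_congr_fun measurableSet_Ioi hscale, integral_const_mul, mul_zero,
      smul_eq_mul] at hi
    rw [← hind, integral_indicator measurableSet_Ioi, Real.rpow_add_one hw.ne', temperedBeta]
    have h3 : ∫ y in Set.Ioi (0 : ℝ), G y = w * (w⁻¹ * ∫ y in Set.Ioi (0 : ℝ), G y) := by
      field_simp
    rw [h3, ← hi]
    ring

/-- The autocorrelation of the one-dimensional factor, off the diagonal. -/
lemma temperedPower_autocorrelation {γ lam : ℝ} (h1 : -1 < γ) (h2 : γ < -1 / 2)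
    (hlam : 0 < lam) {u v : ℝ} (huv : u ≠ v) :
    Integrable (fun x => temperedPower γ lam (u - x) * temperedPower γ lam (v - x)) ∧
    ∫ x, temperedPower γ lam (u - x) * temperedPower γ lam (v - x) =
      |u - v| ^ (2 * γ + 1) * Real.exp (-lam * |u - v|) * temperedBeta γ lam |u - v| := by
  have main : ∀ {u v : ℝ}, u < v →
      Integrable (fun x => temperedPower γ lam (u - x) * temperedPower γ lam (v - x)) ∧
      ∫ x, temperedPower γ lam (u - x) * temperedPower γ lam (v - x) =
        |u - v| ^ (2 * γ + 1) * Real.exp (-lam * |u - v|) * temperedBeta γ lam |u - v| := by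
    intro u v huv
    obtain ⟨hi, he⟩ := temperedPower_autocorrelation_of_pos h1 h2 hlam (sub_pos.2 huv)
    have e : (fun x => temperedPower γ lam (u - x) * temperedPower γ lam (v - x)) =
        fun x => (fun y => temperedPower γ lam y * temperedPower γ lam (v - u + y)) (u - x) := by
      ext x
      simp only
      congr 2
      ring
    rw [e, abs_sub_comm, abs_of_pos (sub_pos.2 huv)]
    exact ⟨hi.comp_sub_left u, (integral_sub_left_eq_self _ volume u).trans he⟩
  rcases lt_or_gt_of_ne huv with h | h
  · exact main h
  · have := main h
    simp_rw [mul_comm (temperedPower γ lam (u - _)), abs_sub_comm u v]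
    exact this

/-! ### Product kernels are powers -/

/-- A homogeneous kernel of product form is a product of powers: the ratio `g₁ (c y) / g₁ y` does
not depend on `y`, so it is multiplicative in `c`. It is thus the square of its value at `√c`, hence
positive, and its `k`-th power is `c ^ α`. -/
lemma IsTemperedHermiteKernel.exists_eq_mul_rpow {k : ℕ} (hk : 1 ≤ k) {α lam : ℝ}
    {g : (Fin k → ℝ) → ℝ} (hg : IsTemperedHermiteKernel k α lam g) {g₁ : ℝ → ℝ}
    (hprod : ∀ x ∈ posOrthant k, g x = ∏ i, g₁ (x i)) :
    ∃ C : ℝ, ∀ y, 0 < y → g₁ y = C * y ^ (α / k) := by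
  have hk0 : k ≠ 0 := by omega
  have hconst : ∀ {c y}, 0 < c → 0 < y → g₁ (c * y) ^ k = c ^ α * g₁ y ^ k := by
    intro c y hc hy
    have h := hg.homogeneous c hc (fun _ => y) fun _ => hy
    rw [hprod _ fun _ => hy, hprod _ fun _ => mul_pos hc hy] at h
    simpa using h
  have hmixed : ∀ {c y}, 0 < c → 0 < y →
      g₁ (c * y) * g₁ c ^ (k - 1) = c ^ α * (g₁ y * g₁ 1 ^ (k - 1)) := by
    intro c y hc hy
    let i₀ : Fin k := ⟨0, hk⟩
    have hx : Function.update (fun _ : Fin k => (1 : ℝ)) i₀ y ∈ posOrthant k := by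
      intro i
      by_cases hi : i = i₀
      · subst hi; simpa using hy
      · simp [Function.update_of_ne hi]
    have h := hg.homogeneous c hc _ hx
    rw [hprod _ hx, hprod _ fun i => mul_pos hc (hx i)] at h
    have e : ∀ b z : ℝ, ∏ i, g₁ (b * Function.update (fun _ : Fin k => (1 : ℝ)) i₀ z i) =
        g₁ (b * z) * g₁ b ^ (k - 1) := by
      intro b z
      rw [← Finset.mul_prod_erase _ _ (Finset.mem_univ i₀), Function.update_self]
      congr 1
      rw [Finset.prod_congr rfl (g := fun _ => g₁ b), Finset.prod_const,
        Finset.card_erase_of_mem (Finset.mem_univ i₀), Finset.card_univ, Fintype.card_fin]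
      intro i hi
      rw [Function.update_of_ne (Finset.ne_of_mem_erase hi), mul_one]
    rw [e] at h
    have e1 := e 1 y
    simp only [one_mul] at e1
    rwa [e1] at h
  have h1 : g₁ 1 ≠ 0 := by
    obtain ⟨x, hx, hgx⟩ := hg.nonzero
    rw [hprod x hx, Finset.prod_ne_zero_iff] at hgx
    have hx0 := hx ⟨0, hk⟩
    intro h0
    have := hconst hx0 one_pos
    rw [h0, zero_pow hk0, mul_zero, mul_one] at this
    exact hgx ⟨0, hk⟩ (Finset.mem_univ _) (pow_eq_zero_iff hk0 |>.1 this)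
  have hne : ∀ {c}, 0 < c → g₁ c ≠ 0 := by
    intro c hc h0
    have := hconst hc one_pos
    rw [mul_one, h0, zero_pow hk0] at this
    exact (mul_ne_zero (Real.rpow_pos_of_pos hc α).ne' (pow_ne_zero k h1)) this.symm
  have hmul : ∀ {c y}, 0 < c → 0 < y → g₁ (c * y) * g₁ 1 = g₁ c * g₁ y := by
    intro c y hc hy
    have h2 := hmixed hc hy
    have h3 := hmixed hc one_pos
    rw [mul_one] at h3
    have hp : g₁ c ^ (k - 1) ≠ 0 := pow_ne_zero _ (hne hc)
    apply mul_right_cancel₀ hp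
    calc g₁ (c * y) * g₁ 1 * g₁ c ^ (k - 1) = g₁ (c * y) * g₁ c ^ (k - 1) * g₁ 1 := by ring
      _ = g₁ y * (c ^ α * (g₁ 1 * g₁ 1 ^ (k - 1))) := by rw [h2]; ring
      _ = g₁ c * g₁ y * g₁ c ^ (k - 1) := by rw [← h3]; ring
  refine ⟨g₁ 1, fun y hy => ?_⟩
  have hs : 0 < √y := Real.sqrt_pos.2 hy
  have hpos : 0 < g₁ y / g₁ 1 := by
    have := hmul hs hs
    rw [Real.mul_self_sqrt hy.le] at this
    have h4 : g₁ y / g₁ 1 = (g₁ √y / g₁ 1) ^ 2 := by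
      field_simp
      linarith
    rw [h4]
    exact sq_pos_of_ne_zero (div_ne_zero (hne hs) h1)
  have hpow : (g₁ y / g₁ 1) ^ k = (y ^ (α / k)) ^ k := by
    rw [← Real.rpow_mul_natCast hy.le, div_mul_cancel₀ _ (Nat.cast_ne_zero.2 hk0), div_pow,
      div_eq_iff (pow_ne_zero k h1)]
    simpa using hconst hy one_pos
  have := (pow_left_inj₀ hpos.le (Real.rpow_nonneg hy.le _) hk0).1 hpow
  rw [← this]
  field_simp

/-! ### The filtered kernel of product form -/

/-- The kernel integrand for `g x = ∏ x_i ^ γ`. -/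
noncomputable def powerIntegrand {k : ℕ} (γ lam β t : ℝ) (x : Fin k → ℝ) (u : ℝ) : ℝ :=
  filterFun β t u * ∏ i, temperedPower γ lam (u - x i)

lemma measurable_powerIntegrand (k : ℕ) (γ lam β t : ℝ) :
    Measurable fun q : (Fin k → ℝ) × ℝ => powerIntegrand γ lam β t q.1 q.2 := by
  refine ((measurable_filterFun β t).comp measurable_snd).mul
    (Finset.measurable_fun_prod _ fun i _ => (measurable_temperedPower γ lam).comp ?_)
  fun_prop

lemma kernelIntegrand_eq {k : ℕ} {γ C : ℝ} {g : (Fin k → ℝ) → ℝ} {g₁ : ℝ → ℝ}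
    (hprod : ∀ x ∈ posOrthant k, g x = ∏ i, g₁ (x i))
    (hg₁ : ∀ y, 0 < y → g₁ y = C * y ^ γ) (lam β t : ℝ) (x : Fin k → ℝ) (u : ℝ) :
    kernelIntegrand g lam β t x u = C ^ k * powerIntegrand γ lam β t x u := by
  by_cases hu : ∀ i, x i < u
  · have hpos : ∀ i, 0 < u - x i := fun i => sub_pos.2 (hu i)
    rw [kernelIntegrand, Set.indicator_of_mem (by exact hu), hprod _ hpos, powerIntegrand,
      Finset.prod_congr rfl (fun i _ => hg₁ _ (hpos i)), Finset.prod_mul_distrib,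
      Finset.prod_const, Finset.card_univ, Fintype.card_fin]
    have : ∀ i, temperedPower γ lam (u - x i) = (u - x i) ^ γ * Real.exp (-lam * (u - x i)) :=
      fun i => Set.indicator_of_mem (Set.mem_Ioi.2 (hpos i)) _
    simp_rw [this]
    rw [Finset.prod_mul_distrib]
    ring
  · rw [kernelIntegrand, Set.indicator_of_notMem (by exact hu), powerIntegrand]
    push Not at hu
    obtain ⟨i, hi⟩ := hu
    have h0 : temperedPower γ lam (u - x i) = 0 :=
      Set.indicator_of_notMem (by simpa using hi) _
    rw [Finset.prod_eq_zero (f := fun i => temperedPower γ lam (u - x i)) (Finset.mem_univ i) h0]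
    simp

lemma powerIntegrand_comp_perm {k : ℕ} (γ lam β t : ℝ) (σ : Equiv.Perm (Fin k))
    (x : Fin k → ℝ) (u : ℝ) :
    powerIntegrand γ lam β t (fun i => x (σ i)) u = powerIntegrand γ lam β t x u := by
  rw [powerIntegrand, powerIntegrand, Equiv.prod_comp σ fun i => temperedPower γ lam (u - x i)]

lemma ae_fst_ne_snd : ∀ᵐ p : ℝ × ℝ, p.1 ≠ p.2 := by
  let L : ℝ × ℝ →ₗ[ℝ] ℝ := LinearMap.fst ℝ ℝ ℝ - LinearMap.snd ℝ ℝ ℝ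
  have hL : LinearMap.ker L ≠ ⊤ := by
    intro hL
    have : ((1, 0) : ℝ × ℝ) ∈ LinearMap.ker L := hL ▸ Submodule.mem_top
    simp [L] at this
  have := Measure.addHaar_submodule volume (LinearMap.ker L) hL
  rw [ae_iff]
  convert this using 2
  ext p
  simp [L, sub_eq_zero]

/-- The inner product of the power integrands at the times `p.1` and `p.2`: the double-filter
weight times the `k`-th power of the autocorrelation of the one-dimensional factor. -/
noncomputable def powerCov (k : ℕ) (γ lam β s t : ℝ) (p : ℝ × ℝ) : ℝ :=
  filterFun β s p.1 * filterFun β t p.2 *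
    (|p.1 - p.2| ^ (2 * γ + 1) * Real.exp (-lam * |p.1 - p.2|) *
      temperedBeta γ lam |p.1 - p.2|) ^ k

lemma powerIntegrand_mul {k : ℕ} (γ lam β s t : ℝ) (x : Fin k → ℝ) (u v : ℝ) :
    powerIntegrand γ lam β s x u * powerIntegrand γ lam β t x v =
      filterFun β s u * filterFun β t v *
        ∏ i, (fun y => temperedPower γ lam (u - y) * temperedPower γ lam (v - y)) (x i) := by
  rw [powerIntegrand, powerIntegrand, Finset.prod_mul_distrib]
  ring

section Fubini

variable {k : ℕ} {γ lam β : ℝ}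

lemma integrable_powerIntegrand_mul (h1 : -1 < γ) (h2 : γ < -1 / 2) (hlam : 0 < lam) {u v : ℝ}
    (huv : u ≠ v) (s t : ℝ) : Integrable fun x : Fin k → ℝ =>
      powerIntegrand γ lam β s x u * powerIntegrand γ lam β t x v := by
  simp_rw [powerIntegrand_mul]
  exact (Integrable.fintype_prod fun _ =>
    (temperedPower_autocorrelation h1 h2 hlam huv).1).const_mul _

lemma integral_powerIntegrand_mul (h1 : -1 < γ) (h2 : γ < -1 / 2) (hlam : 0 < lam) {u v : ℝ}
    (huv : u ≠ v) (s t : ℝ) :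
    ∫ x : Fin k → ℝ, powerIntegrand γ lam β s x u * powerIntegrand γ lam β t x v =
      powerCov k γ lam β s t (u, v) := by
  simp_rw [powerIntegrand_mul]
  rw [integral_const_mul, integral_fintype_prod_volume_eq_pow
    fun y => temperedPower γ lam (u - y) * temperedPower γ lam (v - y), Fintype.card_fin,
    (temperedPower_autocorrelation h1 h2 hlam huv).2, powerCov]

lemma integral_norm_powerIntegrand_mul (h1 : -1 < γ) (h2 : γ < -1 / 2) (hlam : 0 < lam) {u v : ℝ}
    (huv : u ≠ v) (s t : ℝ) :
    ∫ x : Fin k → ℝ, ‖powerIntegrand γ lam β s x u * powerIntegrand γ lam β t x v‖ =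
      |powerCov k γ lam β s t (u, v)| := by
  have hn : ∀ x : Fin k → ℝ, 0 ≤ ∏ i,
      (fun y => temperedPower γ lam (u - y) * temperedPower γ lam (v - y)) (x i) := fun x =>
    Finset.prod_nonneg fun i _ => mul_nonneg (temperedPower_nonneg _ _ _)
      (temperedPower_nonneg _ _ _)
  have hn' : 0 ≤ |u - v| ^ (2 * γ + 1) * Real.exp (-lam * |u - v|) *
      temperedBeta γ lam |u - v| :=
    mul_nonneg (by positivity) (temperedBeta_nonneg _ _ _)
  rw [← integral_powerIntegrand_mul h1 h2 hlam huv]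
  simp_rw [powerIntegrand_mul, norm_mul _ (∏ i, _), Real.norm_of_nonneg (hn _)]
  rw [integral_const_mul, integral_const_mul, abs_mul, Real.norm_eq_abs,
    abs_of_nonneg (integral_nonneg hn)]

lemma abs_powerCov_le (h1 : -1 < γ) (h2 : γ < -1 / 2) (hlam : 0 < lam) (s t : ℝ) (p : ℝ × ℝ) :
    |powerCov k γ lam β s t p| ≤ (∫ x in Set.Ioi (0 : ℝ), x ^ γ * (1 + x) ^ γ) ^ k *
      ‖filterFun β s p.1 * filterFun β t p.2 *
        (|p.1 - p.2| ^ ((2 * γ + 1) * k) * Real.exp (-(lam * k) * |p.1 - p.2|))‖ := by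
  have hw := abs_nonneg (p.1 - p.2)
  have hB := temperedBeta_nonneg γ lam |p.1 - p.2|
  have hB' := temperedBeta_le h1 h2 hlam hw
  have e : Real.exp (-(lam * k) * |p.1 - p.2|) = Real.exp (-lam * |p.1 - p.2|) ^ k := by
    rw [← Real.exp_nat_mul]
    congr 1
    ring
  rw [powerCov, abs_mul, mul_pow, mul_pow, norm_mul, Real.norm_eq_abs, Real.norm_eq_abs,
    Real.rpow_mul_natCast hw, e, abs_of_nonneg (a := _ ^ k * _ ^ k * _ ^ k) (by positivity),
    abs_of_nonneg (a := _ ^ k * _ ^ k) (by positivity)]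
  calc _ = temperedBeta γ lam |p.1 - p.2| ^ k * (|filterFun β s p.1 * filterFun β t p.2| *
        ((|p.1 - p.2| ^ (2 * γ + 1)) ^ k * Real.exp (-lam * |p.1 - p.2|) ^ k)) := by ring
    _ ≤ _ := by gcongr

variable (hk : 1 ≤ k) (hβ : β ≠ 0) (hlam : 0 < lam) (h1 : -1 < (2 * γ + 1) * k)
  (h2 : γ < -1 / 2) (h3 : -((2 * γ + 1) * k) / 2 - 1 < β) (h4 : β < -((2 * γ + 1) * k) / 2)

include hk hβ hlam h1 h2 h3 h4

/-- The absolute convergence that justifies every exchange of integrals. -/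
lemma integrable_powerIntegrand_prod (s t : ℝ) :
    Integrable fun q : (ℝ × ℝ) × (Fin k → ℝ) =>
      powerIntegrand γ lam β s q.2 q.1.1 * powerIntegrand γ lam β t q.2 q.1.2 := by
  have hk' : (1 : ℝ) ≤ k := by exact_mod_cast hk
  have hγ : -1 < γ := by nlinarith
  have hm : AEStronglyMeasurable (fun q : (ℝ × ℝ) × (Fin k → ℝ) =>
      powerIntegrand γ lam β s q.2 q.1.1 * powerIntegrand γ lam β t q.2 q.1.2)
      ((volume : Measure (ℝ × ℝ)).prod volume) :=
    (((measurable_powerIntegrand k γ lam β s).comp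
      (measurable_snd.prodMk measurable_fst.fst)).mul
      ((measurable_powerIntegrand k γ lam β t).comp
        (measurable_snd.prodMk measurable_fst.snd))).aestronglyMeasurable
  refine (integrable_prod_iff hm).2 ⟨?_, ?_⟩
  · filter_upwards [ae_fst_ne_snd] with p hp
    exact integrable_powerIntegrand_mul hγ h2 hlam hp s t
  · refine ((integrable_filterFun_mul_filterFun hβ h1 (by nlinarith)
      (show 0 < lam * k by positivity) h3 h4 s t).norm.const_mul
      ((∫ x in Set.Ioi (0 : ℝ), x ^ γ * (1 + x) ^ γ) ^ k)).mono' hm.norm.integral_prod_right' ?_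
    filter_upwards [ae_fst_ne_snd] with p hp
    rw [integral_norm_powerIntegrand_mul hγ h2 hlam hp, Real.norm_eq_abs, abs_abs]
    exact abs_powerCov_le hγ h2 hlam s t p

lemma integrable_powerCov (s t : ℝ) : Integrable (powerCov k γ lam β s t) := by
  have hk' : (1 : ℝ) ≤ k := by exact_mod_cast hk
  have hγ : -1 < γ := by nlinarith
  refine (integrable_powerIntegrand_prod hk hβ hlam h1 h2 h3 h4 s t).integral_prod_left.congr ?_
  filter_upwards [ae_fst_ne_snd] with p hp
  exact integral_powerIntegrand_mul hγ h2 hlam hp s t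

lemma ae_integrable_powerIntegrand (t : ℝ) :
    ∀ᵐ x : Fin k → ℝ, Integrable (powerIntegrand γ lam β t x) := by
  filter_upwards [(integrable_powerIntegrand_prod hk hβ hlam h1 h2 h3 h4 t t).prod_left_ae]
    with x hx
  have hx' := Integrable.prod_right_ae hx
  by_cases h0 : powerIntegrand γ lam β t x =ᵐ[volume] 0
  · exact (integrable_congr h0).2 (integrable_zero _ _ _)
  · obtain ⟨u, hu0, hu⟩ := ((Filter.not_eventually.1 h0).and_eventually hx').exists
    exact (integrable_const_mul_iff (IsUnit.mk0 _ hu0) _).1 hu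

lemma integrable_integral_powerIntegrand_mul (s t : ℝ) :
    Integrable fun x : Fin k → ℝ =>
      (∫ u, powerIntegrand γ lam β s x u) * ∫ v, powerIntegrand γ lam β t x v := by
  refine (integrable_powerIntegrand_prod hk hβ hlam h1 h2 h3 h4 s t).integral_prod_right.congr
    (Filter.Eventually.of_forall fun x => ?_)
  exact integral_prod_mul (μ := volume) (ν := volume) (powerIntegrand γ lam β s x)
    (powerIntegrand γ lam β t x)

lemma memLp_integral_powerIntegrand (t : ℝ) :
    MemLp (fun x : Fin k → ℝ => ∫ u, powerIntegrand γ lam β t x u) 2 volume := by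
  have hm : StronglyMeasurable fun x : Fin k → ℝ => ∫ u, powerIntegrand γ lam β t x u :=
    (measurable_powerIntegrand k γ lam β t).stronglyMeasurable.integral_prod_right
  refine (memLp_two_iff_integrable_sq hm.aestronglyMeasurable).2 ?_
  simp_rw [sq]
  exact integrable_integral_powerIntegrand_mul hk hβ hlam h1 h2 h3 h4 t t

lemma integral_integral_powerIntegrand_mul (s t : ℝ) :
    ∫ x : Fin k → ℝ, (∫ u, powerIntegrand γ lam β s x u) * ∫ v, powerIntegrand γ lam β t x v =
      ∫ p, powerCov k γ lam β s t p := by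
  have hk' : (1 : ℝ) ≤ k := by exact_mod_cast hk
  have hγ : -1 < γ := by nlinarith
  calc _ = ∫ x : Fin k → ℝ, ∫ p : ℝ × ℝ,
        powerIntegrand γ lam β s x p.1 * powerIntegrand γ lam β t x p.2 := by
        refine integral_congr_ae (Filter.Eventually.of_forall fun x => ?_)
        exact (integral_prod_mul (μ := volume) (ν := volume) (powerIntegrand γ lam β s x)
          (powerIntegrand γ lam β t x)).symm
    _ = ∫ p : ℝ × ℝ, ∫ x : Fin k → ℝ,
        powerIntegrand γ lam β s x p.1 * powerIntegrand γ lam β t x p.2 :=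
        (integral_integral_swap
          (integrable_powerIntegrand_prod hk hβ hlam h1 h2 h3 h4 s t)).symm
    _ = _ := by
        refine integral_congr_ae ?_
        filter_upwards [ae_fst_ne_snd] with p hp
        exact integral_powerIntegrand_mul hγ h2 hlam hp s t

end Fubini

lemma eqOn_mul_mul_exp {γ C : ℝ} {g₁ : ℝ → ℝ} (hg₁ : ∀ y, 0 < y → g₁ y = C * y ^ γ) (lam w : ℝ) :
    Set.EqOn (fun x : ℝ => C ^ 2 * (x ^ γ * (1 + x) ^ γ * Real.exp (-2 * lam * w * x)))
      (fun x => g₁ x * g₁ (1 + x) * Real.exp (-2 * lam * w * x)) (Set.Ioi 0) := by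
  intro x hx
  have hx0 : (0 : ℝ) < x := hx
  simp only
  rw [hg₁ x hx0, hg₁ (1 + x) (by linarith)]
  ring

lemma covIntegrand_eq {k : ℕ} (hk : k ≠ 0) {α C : ℝ} {g₁ : ℝ → ℝ}
    (hg₁ : ∀ y, 0 < y → g₁ y = C * y ^ (α / k)) (lam β s t : ℝ) (p : ℝ × ℝ) :
    covIntegrand k α lam β g₁ s t p = (C ^ k) ^ 2 * powerCov k (α / k) lam β s t p := by
  have hk' : (k : ℝ) ≠ 0 := Nat.cast_ne_zero.2 hk
  rw [covIntegrand, ← setIntegral_congr_fun measurableSet_Ioi (eqOn_mul_mul_exp hg₁ lam _),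
    integral_const_mul, powerCov, mul_pow, mul_pow, mul_pow, ← Real.exp_nat_mul,
    ← Real.rpow_mul_natCast (abs_nonneg _), ← temperedBeta]
  have e1 : (2 * (α / k) + 1) * (k : ℝ) = 2 * α + k := by field_simp
  have e2 : (k : ℝ) * (-lam * |p.1 - p.2|) = -lam * k * |p.1 - p.2| := by ring
  rw [e1, e2]
  ring

end TemperedHermite

/-! ### The covariance formula -/

theorem lemma4p3 {Ω : Type*} [MeasurableSpace Ω] (P : Measure Ω) [IsProbabilityMeasure P]
    (W : Set ℝ → Ω → ℝ) (hW : TemperedHermite.IsWhiteNoise P W)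
    (k : ℕ) (hk : 1 ≤ k) (α lam β : ℝ) (hlam : 0 < lam)
    (hβ_lower : -α - (k : ℝ) / 2 - 1 < β) (hβ_upper : β < -α - (k : ℝ) / 2) (hβ : β ≠ 0)
    (g : (Fin k → ℝ) → ℝ) (hg : TemperedHermite.IsTemperedHermiteKernel k α lam g)
    (g₁ : ℝ → ℝ) (hprod : ∀ x ∈ TemperedHermite.posOrthant k, g x = ∏ i, g₁ (x i))
    (hg₁ : g₁ 0 = 0) :
    -- the process is well defined
    (∀ t : ℝ,
      (∀ᵐ x : Fin k → ℝ, Integrable (TemperedHermite.kernelIntegrand g lam β t x)) ∧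
      MemLp (TemperedHermite.filteredKernel g lam β t) 2 volume ∧
      MemLp (TemperedHermite.filteredProcess P W g lam β t) 2 P) ∧
    -- the integrals on the right-hand side converge absolutely
    (∀ u v : ℝ, u ≠ v → IntegrableOn
      (fun x : ℝ => g₁ x * g₁ (1 + x) * Real.exp (-2 * lam * |u - v| * x)) (Set.Ioi 0)) ∧
    (∀ s t : ℝ, Integrable (TemperedHermite.covIntegrand k α lam β g₁ s t)) ∧
    -- the covariance function
    ∀ s t : ℝ,
      cov[TemperedHermite.filteredProcess P W g lam β t,
          TemperedHermite.filteredProcess P W g lam β s; P] =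
        ∫ ω, TemperedHermite.filteredProcess P W g lam β t ω *
          TemperedHermite.filteredProcess P W g lam β s ω ∂P ∧
      ∫ ω, TemperedHermite.filteredProcess P W g lam β t ω *
          TemperedHermite.filteredProcess P W g lam β s ω ∂P =
        (k.factorial : ℝ) *
          ∫ p : ℝ × ℝ, TemperedHermite.covIntegrand k α lam β g₁ s t p := by
  have hk0 : k ≠ 0 := by omega
  have hk' : (0 : ℝ) < k := by exact_mod_cast hk
  have hk1 : (1 : ℝ) ≤ k := by exact_mod_cast hk
  obtain ⟨C, hC⟩ := hg.exists_eq_mul_rpow hk hprod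
  have hα := hg.lower
  have hα' := hg.upper
  set γ := α / k with hγ
  have e : (2 * γ + 1) * k = 2 * α + k := by
    rw [hγ]
    field_simp
  have h1 : -1 < (2 * γ + 1) * k := by rw [e]; linarith
  have h2 : γ < -1 / 2 := by
    rw [hγ, div_lt_iff₀ hk']
    linarith
  have h3 : -((2 * γ + 1) * k) / 2 - 1 < β := by rw [e]; linarith
  have h4 : β < -((2 * γ + 1) * k) / 2 := by rw [e]; linarith
  have hγ1 : -1 < γ := by nlinarith
  have hfilt : ∀ t, TemperedHermite.filteredKernel g lam β t =
      fun x => C ^ k * ∫ u, TemperedHermite.powerIntegrand γ lam β t x u := by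
    intro t
    ext x
    rw [TemperedHermite.filteredKernel, ← integral_const_mul]
    exact integral_congr_ae (Filter.Eventually.of_forall fun u =>
      TemperedHermite.kernelIntegrand_eq hprod hC lam β t x u)
  have hmem : ∀ t, MemLp (TemperedHermite.filteredKernel g lam β t) 2 volume := by
    intro t
    rw [hfilt]
    exact (TemperedHermite.memLp_integral_powerIntegrand hk hβ hlam h1 h2 h3 h4 t).const_mul _
  have hsymm : ∀ t (σ : Equiv.Perm (Fin k)) x,
      TemperedHermite.filteredKernel g lam β t (fun i => x (σ i)) =
        TemperedHermite.filteredKernel g lam β t x := by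
    intro t σ x
    simp_rw [hfilt, TemperedHermite.powerIntegrand_comp_perm]
  have hcov : ∀ s t, TemperedHermite.covIntegrand k α lam β g₁ s t =
      fun p => (C ^ k) ^ 2 * TemperedHermite.powerCov k γ lam β s t p := fun s t =>
    funext fun p => TemperedHermite.covIntegrand_eq hk0 hC lam β s t p
  have hZ : ∀ t, MemLp (TemperedHermite.filteredProcess P W g lam β t) 2 P := fun t =>
    TemperedHermite.memLp_wienerItoIntegral hW (hmem t)
  refine ⟨fun t => ⟨?_, hmem t, hZ t⟩, fun u v _ => ?_, fun s t => ?_, fun s t => ⟨?_, ?_⟩⟩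
  · filter_upwards [TemperedHermite.ae_integrable_powerIntegrand hk hβ hlam h1 h2 h3 h4 t]
      with x hx
    exact (hx.const_mul (C ^ k)).congr (Filter.Eventually.of_forall fun u =>
      (TemperedHermite.kernelIntegrand_eq hprod hC lam β t x u).symm)
  · exact IntegrableOn.congr_fun ((TemperedHermite.integrableOn_temperedBeta hγ1 h2 hlam
      (abs_nonneg (u - v))).const_mul (C ^ 2)) (TemperedHermite.eqOn_mul_mul_exp hC lam _)
      measurableSet_Ioi
  · rw [hcov]
    exact (TemperedHermite.integrable_powerCov hk hβ hlam h1 h2 h3 h4 s t).const_mul _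
  · have h0 : ∫ ω, TemperedHermite.filteredProcess P W g lam β t ω ∂P = 0 :=
      TemperedHermite.integral_wienerItoIntegral hW hk (hmem t)
    rw [covariance_eq_sub (hZ t) (hZ s), h0, zero_mul, sub_zero]
    rfl
  · simp only [TemperedHermite.filteredProcess]
    rw [TemperedHermite.integral_wienerItoIntegral_mul hW (hmem t) (hmem s) (hsymm s), hcov,
      integral_const_mul,
      ← TemperedHermite.integral_integral_powerIntegrand_mul hk hβ hlam h1 h2 h3 h4 s t,
      ← integral_const_mul ((C ^ k) ^ 2), hfilt, hfilt]
    congr 1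
    refine integral_congr_ae (Filter.Eventually.of_forall fun x => ?_)
    simp only
    ring
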